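/- Let a system $\mathcal S$ have Hilbert space $\mathbb C^d$ with basis $|a\rangle$, and for every $N$ let the environment $\mathcal E_N$ consist of $N$ sites with local Hilbert space $\mathbb C^q$ and have a Hamiltonian $H_{\mathcal E_N}=\sum_X h_X$, where the self-adjoint term $h_X$ acts on the set of sites $X$. For a set $\mathcal F$ of sites let $H_{\mathcal F}=\sum_{X\subseteq\mathcal F}h_X$. For every $N$ fix a class of admissible fractions (sets of sites of $\mathcal E_N$; for instance all sets, or all arcs of a ring) that contains the complement of each of its members. Let $|\Psi\rangle=\sum_a c_a|a\rangle|\Phi_a(t)\rangle$ with $|c_a|^2>0$, $\sum_a|c_a|^2=1$ (the $c_a$ independent of $N$), $|\Phi_a(t)\rangle=e^{-iH_{\mathcal E_N}t}|\Phi_a\rangle$, and $|\Phi_a\rangle$ unit vectors of $\mathcal E_N$; the $|\Phi_a\rangle$ and the time $t$ may depend on $N$. Assume that for every $a$ the distribution of the energy density $H_{\mathcal F}/n$ of a fraction $\mathcal F$ of size $n=|\mathcal F|$ in the state $|\Phi_a(t)\rangle$ satisfies, as $n\to\infty$ and uniformly in $N$ and in the admissible fractions $\mathcal F$ of size $n$,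 a large deviation principle with speed $n$ and lower semicontinuous rate function $f_a:\mathbb R\to[0,\infty]$. Put $$\alpha_*=\inf_{a\neq b}\ \inf_{\epsilon\in\mathbb R}\ \max(f_a(\epsilon),f_b(\epsilon))\in[0,\infty].$$ Let $H(\mathcal X)=-\mathrm{tr}\,\rho_{\mathcal X}\ln\rho_{\mathcal X}$ be the von Neumann entropy of the reduced state of $|\Psi\rangle$ on $\mathcal X$, and let $I(\mathcal F,\mathcal S)=H(\mathcal F)+H(\mathcal S)-H(\mathcal F\mathcal S)$. 1. For every real $\alpha<\alpha_*$ there is a constant $C>0$ such that for every $N$ and every admissible fraction $\mathcal F$ of $\mathcal E_N$, of size $n$, $$H(\mathcal S)-Ce^{-\alpha n}\ \le\ I(\mathcal F,\mathcal S)\ \le\ H(\mathcal S)+Ce^{-\alpha(N-n)}.$$ 2. If $\alpha_*>0$, there are $\gamma>0$ and $C>0$ such that $\bigl|H(\mathcal S)+\sum_a|c_a|^2\ln|c_a|^2\bigr|\le Ce^{-\gamma N}$ for every $N$ for which $\mathcal E_N$ has an admissible fraction. -/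

import Mathlib

open scoped ENNReal

noncomputable section

namespace Redundancy

/-! ### Large deviation principle -/

/-- A family of measures `μ i` on `ℝ`, indexed along a filter `l`, satisfies the (full) large
deviation principle with speed `r i` and rate function `f : ℝ → [0, ∞]`: `f` is lower
semicontinuous, `limsup (1 / r) log μ(K) ≤ - inf_K f` for closed `K`, and
`liminf (1 / r) log μ(U) ≥ - inf_U f` for open `U`. -/
structure IsLDP {ι : Type*} (l : Filter ι) (r : ι → ℕ) (μ : ι → MeasureTheory.Measure ℝ)
    (f : ℝ → ℝ≥0∞) : Prop where
  lsc : LowerSemicontinuous f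
  upper : ∀ K : Set ℝ, IsClosed K →
    Filter.limsup (fun i => ENNReal.log (μ i K) / ((r i : ℝ) : EReal)) l
      ≤ -((⨅ x ∈ K, f x : ℝ≥0∞) : EReal)
  lower : ∀ U : Set ℝ, IsOpen U →
    -((⨅ x ∈ U, f x : ℝ≥0∞) : EReal)
      ≤ Filter.liminf (fun i => ENNReal.log (μ i U) / ((r i : ℝ) : EReal)) l

/-- `α_* = min_{a ≠ b} min_ε max (f_a ε, f_b ε)`, as an element of `[0, ∞]`. -/
def alphaStar {d : ℕ} (f : Fin d → ℝ → ℝ≥0∞) : ℝ≥0∞ :=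
  ⨅ (a : Fin d) (b : Fin d) (_ : a ≠ b) (ε : ℝ), max (f a ε) (f b ε)

/-! ### Density matrices and entropy -/

/-- The matrix `|v⟩⟨v|`. -/
def pureState {ι : Type*} (v : EuclideanSpace ℂ ι) : Matrix ι ι ℂ :=
  Matrix.of fun i j => v i * star (v j)

/-- Partial trace over the second tensor factor. -/
def traceRight {m k : Type*} [Fintype k] (ρ : Matrix (m × k) (m × k) ℂ) : Matrix m m ℂ :=
  Matrix.of fun i j => ∑ z, ρ (i, z) (j, z)

/-- Partial trace over the first tensor factor. -/
def traceLeft {m k : Type*} [Fintype m] (ρ : Matrix (m × k) (m × k) ℂ) : Matrix k k ℂ :=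
  Matrix.of fun i j => ∑ z, ρ (z, i) (z, j)

theorem pureState_isHermitian {ι : Type*} (v : EuclideanSpace ℂ ι) :
    (pureState v).IsHermitian := by
  ext i j
  simp [pureState, mul_comm]

theorem traceRight_isHermitian {m k : Type*} [Fintype k] {ρ : Matrix (m × k) (m × k) ℂ}
    (h : ρ.IsHermitian) : (traceRight ρ).IsHermitian := by
  ext i j
  simp only [traceRight, Matrix.conjTranspose_apply, Matrix.of_apply, star_sum]
  exact Finset.sum_congr rfl fun z _ => h.apply _ _

theorem traceLeft_isHermitian {m k : Type*} [Fintype m] {ρ : Matrix (m × k) (m × k) ℂ}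
    (h : ρ.IsHermitian) : (traceLeft ρ).IsHermitian := by
  ext i j
  simp only [traceLeft, Matrix.conjTranspose_apply, Matrix.of_apply, star_sum]
  exact Finset.sum_congr rfl fun z _ => h.apply _ _

/-- The von Neumann entropy `tr (- ρ ln ρ)`, the sum of `- λ ln λ` over the eigenvalues of `ρ`. -/
def entropy {ι : Type*} [Fintype ι] [DecidableEq ι] (ρ : Matrix ι ι ℂ) (hρ : ρ.IsHermitian) : ℝ :=
  ∑ i, Real.negMulLog (hρ.eigenvalues i)

/-- The law of the outcome of a measurement of the observable `A / n` in the state `v`: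
the measure `∑ i, |⟨u i, v⟩|² δ_{E i / n}` where `u` is an orthonormal eigenbasis of `A` with
eigenvalues `E`. -/
def observableLaw {ι : Type*} [Fintype ι] [DecidableEq ι] {A : Matrix ι ι ℂ} (hA : A.IsHermitian)
    (n : ℕ) (v : EuclideanSpace ℂ ι) : MeasureTheory.Measure ℝ :=
  ∑ i, ENNReal.ofReal (‖inner ℂ (hA.eigenvectorBasis i) v‖ ^ 2) •
    MeasureTheory.Measure.dirac (hA.eigenvalues i / n)

/-! ### The environment: `N` sites with local Hilbert space `ℂ^q` -/

/-- Basis configurations of the sites in `X`; the Hilbert space of these sites is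
`EuclideanSpace ℂ (Config q X)`. -/
abbrev Config (q : ℕ) {N : ℕ} (X : Finset (Fin N)) : Type := X → Fin q

/-- The operator `A ⊗ 1` on the whole environment, where `A` acts on the sites in `X`. -/
def embed {q N : ℕ} (X : Finset (Fin N)) (A : Matrix (Config q X) (Config q X) ℂ) :
    Matrix (Fin N → Fin q) (Fin N → Fin q) ℂ :=
  Matrix.of fun σ τ =>
    if ∀ j, j ∉ X → σ j = τ j then A (fun j => σ j) (fun j => τ j) else 0

theorem embed_isHermitian {q N : ℕ} (X : Finset (Fin N)) {A : Matrix (Config q X) (Config q X) ℂ}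
    (h : A.IsHermitian) : (embed X A).IsHermitian := by
  ext σ τ
  simp only [embed, Matrix.conjTranspose_apply, Matrix.of_apply]
  by_cases hc : ∀ j, j ∉ X → σ j = τ j
  · have hc' : ∀ j, j ∉ X → τ j = σ j := fun j hj => (hc j hj).symm
    rw [if_pos hc, if_pos hc']
    exact h.apply _ _
  · have hc' : ¬ ∀ j, j ∉ X → τ j = σ j := fun g => hc fun j hj => (g j hj).symm
    rw [if_neg hc, if_neg hc', star_zero]

/-- A Hamiltonian on `N` sites, given as a sum of self-adjoint terms: `term X` acts on the sites
in `X`. -/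
structure Interaction (q N : ℕ) where
  term : (X : Finset (Fin N)) → Matrix (Config q X) (Config q X) ℂ
  isHermitian : ∀ X, (term X).IsHermitian

/-- The Hamiltonian restricted to `F`: the sum of all terms acting inside `F`, as an operator on
the whole environment. For `F = Finset.univ` it is the full Hamiltonian. -/
def Interaction.ham {q N : ℕ} (h : Interaction q N) (F : Finset (Fin N)) :
    Matrix (Fin N → Fin q) (Fin N → Fin q) ℂ :=
  ∑ X ∈ F.powerset, embed X (h.term X)

theorem Interaction.ham_isHermitian {q N : ℕ} (h : Interaction q N) (F : Finset (Fin N)) :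
    (h.ham F).IsHermitian := by
  unfold Interaction.ham Matrix.IsHermitian
  rw [Matrix.conjTranspose_sum]
  exact Finset.sum_congr rfl fun X _ => embed_isHermitian X (h.isHermitian X)

/-- Time evolution `exp (-i t H) φ` under the full Hamiltonian `H`. -/
def Interaction.evolve {q N : ℕ} (h : Interaction q N) (t : ℝ)
    (φ : EuclideanSpace ℂ (Fin N → Fin q)) : EuclideanSpace ℂ (Fin N → Fin q) :=
  WithLp.toLp 2
    ((NormedSpace.exp ((-(Complex.I * t)) • h.ham Finset.univ)).mulVec (WithLp.ofLp φ))

/-- The law of the energy density `H_F / |F|` of the fraction `F` in the state `φ`. -/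
def energyLaw {q N : ℕ} (h : Interaction q N) (F : Finset (Fin N))
    (φ : EuclideanSpace ℂ (Fin N → Fin q)) : MeasureTheory.Measure ℝ :=
  observableLaw (h.ham_isHermitian F) F.card φ

/-! ### System and environment -/

/-- The state `∑ a, c a |a⟩ ⊗ |φ a⟩` of system and environment. -/
def branchState {d q N : ℕ} (c : Fin d → ℂ) (φ : Fin d → EuclideanSpace ℂ (Fin N → Fin q)) :
    EuclideanSpace ℂ (Fin d × (Fin N → Fin q)) :=
  WithLp.toLp 2 fun p => c p.1 * φ p.1 p.2

/-- The configuration of the environment that is `x` on `F` and `z` outside `F`. -/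
def glue {q N : ℕ} {F : Finset (Fin N)} (x : Config q F) (z : {j // j ∉ F} → Fin q) :
    Fin N → Fin q :=
  fun j => if hj : j ∈ F then x ⟨j, hj⟩ else z ⟨j, hj⟩

/-- The state `Ψ`, with the Hilbert space factored as (system ⊗ fraction `F`) ⊗ (rest). -/
def split {d q N : ℕ} (F : Finset (Fin N)) (Ψ : EuclideanSpace ℂ (Fin d × (Fin N → Fin q))) :
    EuclideanSpace ℂ ((Fin d × Config q F) × ({j // j ∉ F} → Fin q)) :=
  WithLp.toLp 2 fun p => Ψ (p.1.1, glue p.1.2 p.2)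

/-- The reduced density matrix of the system. -/
def rhoS {d q N : ℕ} (Ψ : EuclideanSpace ℂ (Fin d × (Fin N → Fin q))) : Matrix (Fin d) (Fin d) ℂ :=
  traceRight (pureState Ψ)

/-- The reduced density matrix of the system and the fraction `F`. -/
def rhoSF {d q N : ℕ} (F : Finset (Fin N)) (Ψ : EuclideanSpace ℂ (Fin d × (Fin N → Fin q))) :
    Matrix (Fin d × Config q F) (Fin d × Config q F) ℂ :=
  traceRight (pureState (split F Ψ))

/-- The reduced density matrix of the fraction `F`. -/
def rhoF {d q N : ℕ} (F : Finset (Fin N)) (Ψ : EuclideanSpace ℂ (Fin d × (Fin N → Fin q))) :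
    Matrix (Config q F) (Config q F) ℂ :=
  traceLeft (rhoSF F Ψ)

theorem rhoS_isHermitian {d q N : ℕ} (Ψ : EuclideanSpace ℂ (Fin d × (Fin N → Fin q))) :
    (rhoS Ψ).IsHermitian :=
  traceRight_isHermitian (pureState_isHermitian Ψ)

theorem rhoSF_isHermitian {d q N : ℕ} (F : Finset (Fin N))
    (Ψ : EuclideanSpace ℂ (Fin d × (Fin N → Fin q))) : (rhoSF F Ψ).IsHermitian :=
  traceRight_isHermitian (pureState_isHermitian (split F Ψ))

theorem rhoF_isHermitian {d q N : ℕ} (F : Finset (Fin N))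
    (Ψ : EuclideanSpace ℂ (Fin d × (Fin N → Fin q))) : (rhoF F Ψ).IsHermitian :=
  traceLeft_isHermitian (rhoSF_isHermitian F Ψ)

/-- `H(S)`. -/
def entropyS {d q N : ℕ} (Ψ : EuclideanSpace ℂ (Fin d × (Fin N → Fin q))) : ℝ :=
  entropy (rhoS Ψ) (rhoS_isHermitian Ψ)

/-- The mutual information `I(F, S) = H(F) + H(S) - H(FS)`. -/
def mutualInfo {d q N : ℕ} (F : Finset (Fin N))
    (Ψ : EuclideanSpace ℂ (Fin d × (Fin N → Fin q))) : ℝ :=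
  entropy (rhoF F Ψ) (rhoF_isHermitian F Ψ) + entropyS Ψ
    - entropy (rhoSF F Ψ) (rhoSF_isHermitian F Ψ)

/-- The limit `|F| → ∞` along the fractions `F ∈ 𝓕 N` of the `N`-site environments, uniformly
in `N` and in `F`. -/
def largeFractions (𝓕 : (N : ℕ) → Set (Finset (Fin N))) :
    Filter ((N : ℕ) × {F : Finset (Fin N) // F ∈ 𝓕 N}) :=
  Filter.comap (fun p => p.2.1.card) Filter.atTop

end Redundancy

end

/-!
The mutual information exceeds `H(S)` by `H(F) - H(SF)`, which is minus the conditional entropy of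
the system given the fraction `F`. Everything reduces to the lower bound
`H(F) - H(SF) ≥ -C exp (-α |F|)`: the global state is pure, so `H(SF) = H(Fᶜ)` and
`H(F) = H(S Fᶜ)` (`entropy_rhoSF_eq`, `entropy_rhoF_eq`), and the upper bound is the lower bound
for the complementary fraction.

For the lower bound, `H(F) - H(SF)` is the relative entropy of `ρ_SF` and `1 ⊗ ρ_F`. A measurement
cannot increase it; if one measures whether the energy density of `F` lies in a region `U a`
belonging to the actual branch `a`, the outcome "no" has a small probability `δ`, and what remains
is Fano's bound `(1 - δ) log (1 - δ) + δ (log δ - log d)` (`fano_le_entropy_sub_entropy`,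
`fano_energyLaw`). Using this inequality, and not a continuity estimate for the entropy, is what
gives the full exponent `α` and a constant that does not depend on the dimension of the environment.
The energy `H_F` acts on `F` only, so its spectral projections are operators on `F`
(`Interaction.exists_projection`).

The monotonicity under the measurement (`measured_relative_entropy_le`) is proved by hand. In
eigenbases of `ρ` and `σ` with eigenvalues `r i`, `s j` and overlaps `w i j`, the relative entropy
is the integral over `T` of `∑ w i j * r i ^ 2 / (s j + T * r i)`, up to a term that depends on
`T` and the trace only. This quadratic form is the maximum over operators `X` of
`2 Re tr (X ρ) - tr (X σ Xᴴ) - T tr (Xᴴ ρ X)`, and restricting `X` to the span of the measured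
projections gives the form of the measured distributions.

The regions `U a` come from the large deviation principle (`exists_separating_regions`): for
`β < α_*` the sublevel sets `{f a ≤ β}` are closed and pairwise disjoint, so they have disjoint open
neighbourhoods `U a`, and the upper bound on the closed set `(U a)ᶜ` gives an error
`exp (-β n)`. A rate `β` strictly between `α` and `α_*` absorbs the logarithm in Fano's bound.

For the entropy of the system, the same regions show that distinct branch states are nearly
orthogonal (`norm_inner_sq_le`), by measuring whichever of `F`, `Fᶜ` has at least half of the sites.
The off-diagonal entries of `ρ_S` are then exponentially small, and they control the gap between
`H(S)` and the entropy of the diagonal quadratically (`entropy_le_sum_negMulLog_diag`).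
-/

namespace Redundancy

open Matrix
open scoped ComplexOrder

/-! ### Relative entropy and a two-outcome measurement -/

theorem hasDerivAt_mul_log_add {r s T : ℝ} (hr : 0 ≤ r) (hs : 0 < s) (hT : 0 ≤ T) :
    HasDerivAt (fun T => r * (Real.log (s + T * r) - Real.log s)) (r ^ 2 / (s + T * r)) T := by
  have hpos : 0 < s + T * r := by positivity
  have h1 : HasDerivAt (fun T : ℝ => s + T * r) r T := by
    simpa using ((hasDerivAt_id T).mul_const r).const_add s
  exact (((h1.log hpos.ne').sub_const (Real.log s)).const_mul r).congr_deriv (by ring)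

theorem tendsto_mul_log_add {r s : ℝ} (hr : 0 ≤ r) (hs : 0 < s) :
    Filter.Tendsto (fun T => r * (Real.log (s + T * r) - Real.log s) - r * Real.log T)
      Filter.atTop (nhds (r * (Real.log r - Real.log s))) := by
  rcases hr.eq_or_lt with rfl | hr
  · simp
  have h1 : Filter.Tendsto (fun T : ℝ => r * (Real.log (s / T + r) - Real.log s)) Filter.atTop
      (nhds (r * (Real.log r - Real.log s))) := by
    have h0 : Filter.Tendsto (fun T : ℝ => s / T + r) Filter.atTop (nhds r) := by
      simpa using (Filter.Tendsto.div_atTop (tendsto_const_nhds (x := s))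
        Filter.tendsto_id).add_const r
    exact ((h0.log hr.ne').sub_const _).const_mul r
  refine h1.congr' ?_
  filter_upwards [Filter.eventually_gt_atTop 0] with T hT
  have : s / T + r = (s + T * r) / T := by field_simp
  rw [this, Real.log_div (by positivity) hT.ne']
  ring

/-- If the resolvent-type quadratic forms `∑ w r² / (s + T r)` of one pair of weights dominate
those of a two-point pair `(p, Q)`, `(p', Q')` for every `T > 0`, so do the relative entropies:
both are obtained by integrating the forms over `T`. -/
theorem log_ratio_le_of_resolvent_le {κ : Type*} [Fintype κ] (w r s : κ → ℝ)
    (hr : ∀ k, 0 ≤ r k) (hs : ∀ k, 0 ≤ s k)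
    (hsupp : ∀ k, s k = 0 → w k * r k = 0) {p p' Q Q' : ℝ} (hp : 0 ≤ p) (hp' : 0 ≤ p')
    (hQ : 0 < Q) (hQ' : 0 < Q') (hsum : ∑ k, w k * r k = p + p')
    (hle : ∀ T : ℝ, 0 < T → p ^ 2 / (Q + T * p) + p' ^ 2 / (Q' + T * p') ≤
      ∑ k, w k * (r k ^ 2 / (s k + T * r k))) :
    p * (Real.log p - Real.log Q) + p' * (Real.log p' - Real.log Q') ≤
      ∑ k, w k * (r k * (Real.log (r k) - Real.log (s k))) := by
  let L : ℝ → ℝ → ℝ → ℝ := fun r s T => r * (Real.log (s + T * r) - Real.log s)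
  let G : ℝ → ℝ := fun T => ∑ k, w k * L (r k) (s k) T - (L p Q T + L p' Q' T)
  have hterm : ∀ k T, 0 ≤ T → HasDerivAt (fun T => w k * L (r k) (s k) T)
      (w k * (r k ^ 2 / (s k + T * r k))) T := by
    intro k T hT
    rcases (hs k).eq_or_lt with h0 | h0
    -- for `s k = 0` the logarithm is a junk value, but its coefficient vanishes
    · have hz := hsupp k h0.symm
      have e1 : (fun T => w k * L (r k) (s k) T) = fun _ => 0 := by
        funext T
        simp only [L, ← mul_assoc, hz, zero_mul]
      have e2 : w k * (r k ^ 2 / (s k + T * r k)) = 0 := by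
        rw [pow_two, mul_div_assoc, ← mul_assoc, hz, zero_mul]
      rw [e1, e2]
      exact hasDerivAt_const _ _
    · exact (hasDerivAt_mul_log_add (hr k) h0 hT).const_mul _
  have hG : ∀ T, 0 ≤ T → HasDerivAt G (∑ k, w k * (r k ^ 2 / (s k + T * r k)) -
      (p ^ 2 / (Q + T * p) + p' ^ 2 / (Q' + T * p'))) T := by
    intro T hT
    exact (HasDerivAt.fun_sum fun k _ => hterm k T hT).sub
      ((hasDerivAt_mul_log_add hp hQ hT).add (hasDerivAt_mul_log_add hp' hQ' hT))
  have hmono : MonotoneOn G (Set.Ici 0) := by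
    refine monotoneOn_of_deriv_nonneg (convex_Ici 0)
      (fun T hT => (hG T hT).continuousAt.continuousWithinAt)
      (fun T hT => ?_) (fun T hT => ?_)
    · rw [interior_Ici] at hT
      exact (hG T (le_of_lt hT)).differentiableAt.differentiableWithinAt
    · rw [interior_Ici] at hT
      rw [(hG T (le_of_lt hT)).deriv, sub_nonneg]
      exact hle T hT
  have hG0 : G 0 = 0 := by simp [G, L]
  have hlim : Filter.Tendsto G Filter.atTop
      (nhds (∑ k, w k * (r k * (Real.log (r k) - Real.log (s k))) -
        (p * (Real.log p - Real.log Q) + p' * (Real.log p' - Real.log Q')))) := by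
    have h1 : Filter.Tendsto (fun T => ∑ k, w k * (L (r k) (s k) T - r k * Real.log T))
        Filter.atTop (nhds (∑ k, w k * (r k * (Real.log (r k) - Real.log (s k))))) := by
      refine tendsto_finsetSum _ fun k _ => ?_
      rcases (hs k).eq_or_lt with h0 | h0
      · have hz := hsupp k h0.symm
        simp only [L, mul_sub, ← mul_assoc, hz, zero_mul, sub_zero]
        exact tendsto_const_nhds
      · exact (tendsto_mul_log_add (hr k) h0).const_mul _
    refine (h1.sub ((tendsto_mul_log_add hp hQ).add (tendsto_mul_log_add hp' hQ'))).congr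
      fun T => ?_
    have : ∑ k, w k * (L (r k) (s k) T - r k * Real.log T) =
        ∑ k, w k * L (r k) (s k) T - (p + p') * Real.log T := by
      rw [← hsum, Finset.sum_mul, ← Finset.sum_sub_distrib]
      exact Finset.sum_congr rfl fun k _ => by ring
    rw [this]
    simp only [G, L]
    ring
  have hnonneg := ge_of_tendsto hlim (b := 0) (by
    filter_upwards [Filter.eventually_ge_atTop 0] with T hT
    rw [← hG0]
    exact hmono Set.self_mem_Ici hT hT)
  linarith

/-- Completing the square in `y`; this is the variational bound for a single matrix entry. For
`s + T r = 0` both sides vanish. -/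
theorem two_mul_re_sub_le {v y : ℂ} {r s T : ℝ} (hr : 0 ≤ r) (hs : 0 ≤ s) (hT : 0 < T) :
    2 * (r * (y * star v).re) - ‖y‖ ^ 2 * s - T * (‖y‖ ^ 2 * r) ≤
      ‖v‖ ^ 2 * (r ^ 2 / (s + T * r)) := by
  have hre : (y * star v).re ≤ ‖y‖ * ‖v‖ := by
    refine (Complex.re_le_norm _).trans ?_
    simp
  rcases (show 0 ≤ s + T * r by positivity).eq_or_lt with h0 | h0
  · have h1 : s = 0 := by nlinarith [mul_nonneg hT.le hr]
    have h2 : r = 0 := by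
      have : T * r = 0 := by linarith
      exact (mul_eq_zero.1 this).resolve_left hT.ne'
    simp [h1, h2]
  · rw [← mul_div_assoc, le_div_iff₀ h0]
    have := mul_le_mul_of_nonneg_left hre hr
    nlinarith [sq_nonneg (‖y‖ * (s + T * r) - ‖v‖ * r)]

variable {n : Type*} [Fintype n] [DecidableEq n]

theorem trace_diagonal_mul_mul_conjTranspose (a : n → ℝ) (Y Z : Matrix n n ℂ) :
    (trace (diagonal (fun i => (a i : ℂ)) * Y * Zᴴ)).re =
      ∑ i, ∑ j, a i * (Y i j * star (Z i j)).re := by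
  rw [trace, Complex.re_sum]
  refine Finset.sum_congr rfl fun i _ => ?_
  rw [diag_apply, mul_apply, Complex.re_sum]
  refine Finset.sum_congr rfl fun j _ => ?_
  rw [diagonal_mul, conjTranspose_apply, mul_assoc, Complex.re_ofReal_mul]

theorem mul_star_re (z : ℂ) : (z * star z).re = ‖z‖ ^ 2 := by
  simp [Complex.mul_conj, Complex.normSq_eq_norm_sq]
  norm_cast

theorem trace_mul_diagonal_mul_conjTranspose (a : n → ℝ) (Y : Matrix n n ℂ) :
    (trace (Y * diagonal (fun i => (a i : ℂ)) * Yᴴ)).re = ∑ i, ∑ j, ‖Y i j‖ ^ 2 * a j := by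
  rw [trace, Complex.re_sum]
  refine Finset.sum_congr rfl fun i _ => ?_
  rw [diag_apply, mul_apply, Complex.re_sum]
  refine Finset.sum_congr rfl fun j _ => ?_
  rw [mul_diagonal, conjTranspose_apply, mul_right_comm, mul_comm, Complex.re_ofReal_mul, mul_star_re, mul_comm]

theorem conjTranspose_mul_diagonal_mul_apply (a : n → ℝ) (V : Matrix n n ℂ) (j : n) :
    ((Vᴴ * diagonal (fun i => (a i : ℂ)) * V) j j).re = ∑ i, ‖V i j‖ ^ 2 * a i := by
  rw [mul_apply, Complex.re_sum]
  refine Finset.sum_congr rfl fun i _ => ?_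
  rw [mul_diagonal, conjTranspose_apply, mul_right_comm, mul_comm, Complex.re_ofReal_mul, mul_comm (star _), mul_star_re, mul_comm]

theorem sum_norm_sq_row {V : Matrix n n ℂ} (hV : V * Vᴴ = 1) (i : n) :
    ∑ j, ‖V i j‖ ^ 2 = 1 := by
  have := congrArg (fun M => (M i i).re) hV
  simp only [mul_apply, conjTranspose_apply, Complex.re_sum, one_apply_eq, Complex.one_re] at this
  rw [← this]
  exact Finset.sum_congr rfl fun j _ => (mul_star_re _).symm

theorem sum_norm_sq_col {V : Matrix n n ℂ} (hV : Vᴴ * V = 1) (j : n) :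
    ∑ i, ‖V i j‖ ^ 2 = 1 := by
  have := congrArg (fun M => (M j j).re) hV
  simp only [mul_apply, conjTranspose_apply, Complex.re_sum, one_apply_eq, Complex.one_re] at this
  rw [← this]
  exact Finset.sum_congr rfl fun i _ => by rw [mul_comm, mul_star_re]

/-- Monotonicity of the relative entropy of `ρ` and `σ` under the measurement with outcomes `P`
and `1 - P`. The matrices enter through spectral decompositions; `σ` need not be normalized, and
`Q`, `Q'` are upper bounds of the weights `σ` gives to the two outcomes. -/
theorem measured_relative_entropy_le {ρ σ P U W : Matrix n n ℂ} {r s : n → ℝ}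
    (hU : Uᴴ * U = 1) (hW : Wᴴ * W = 1)
    (hρ : ρ = U * diagonal (fun i => (r i : ℂ)) * Uᴴ)
    (hσ : σ = W * diagonal (fun i => (s i : ℂ)) * Wᴴ)
    (hr : ∀ i, 0 ≤ r i) (hs : ∀ i, 0 ≤ s i)
    (hsupp : ∀ j, s j = 0 → ((Wᴴ * ρ * W) j j).re = 0)
    (hP : Pᴴ = P) (hPP : P * P = P) {p p' Q Q' : ℝ}
    (hp : (trace (ρ * P)).re = p) (hp' : (trace (ρ * (1 - P))).re = p')
    (hp0 : 0 ≤ p) (hp0' : 0 ≤ p') (hQ : 0 < Q) (hQ' : 0 < Q')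
    (hq : (trace (σ * P)).re ≤ Q) (hq' : (trace (σ * (1 - P))).re ≤ Q') :
    p * (Real.log p - Real.log Q) + p' * (Real.log p' - Real.log Q') ≤
      ∑ i, r i * Real.log (r i) - ∑ j, ((Wᴴ * ρ * W) j j).re * Real.log (s j) := by
  have hU' : U * Uᴴ = 1 := mul_eq_one_comm.1 hU
  have hW' : W * Wᴴ = 1 := mul_eq_one_comm.1 hW
  set V : Matrix n n ℂ := Uᴴ * W with hVdef
  have hVV : V * Vᴴ = 1 := by
    rw [hVdef, conjTranspose_mul, conjTranspose_conjTranspose, mul_assoc, ← mul_assoc W, hW',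
      one_mul, hU]
  have hdiag : ∀ j, ((Wᴴ * ρ * W) j j).re = ∑ i, ‖V i j‖ ^ 2 * r i := by
    intro j
    rw [← conjTranspose_mul_diagonal_mul_apply, hρ, hVdef, conjTranspose_mul,
      conjTranspose_conjTranspose]
    simp only [mul_assoc]
  have hsupp' : ∀ k : n × n, s k.2 = 0 → ‖V k.1 k.2‖ ^ 2 * r k.1 = 0 := by
    intro k hk
    have h1 := (hdiag k.2).symm.trans (hsupp k.2 hk)
    exact (Finset.sum_eq_zero_iff_of_nonneg fun i _ => mul_nonneg (sq_nonneg _) (hr i)).1 h1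
      k.1 (Finset.mem_univ _)
  have htr : p + p' = (trace ρ).re := by
    rw [← hp, ← hp', ← Complex.add_re, ← trace_add, ← mul_add, add_sub_cancel, mul_one]
  have hsum : ∑ k : n × n, ‖V k.1 k.2‖ ^ 2 * r k.1 = p + p' := by
    rw [Fintype.sum_prod_type, htr, hρ, trace_mul_comm, ← mul_assoc, hU, one_mul, trace_diagonal,
      Complex.re_sum]
    refine Finset.sum_congr rfl fun i _ => ?_
    simp only
    rw [← Finset.sum_mul, sum_norm_sq_row hVV, one_mul, Complex.ofReal_re]
  have key := log_ratio_le_of_resolvent_le (κ := n × n) (fun k => ‖V k.1 k.2‖ ^ 2)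
    (fun k => r k.1) (fun k => s k.2) (fun k => hr _) (fun k => hs _) hsupp' hp0 hp0' hQ hQ' hsum
    (fun T hT => ?_)
  · refine key.trans (le_of_eq ?_)
    rw [Fintype.sum_prod_type]
    have e1 : ∑ i, r i * Real.log (r i) = ∑ i, ∑ j, ‖V i j‖ ^ 2 * (r i * Real.log (r i)) :=
      Finset.sum_congr rfl fun i _ => by rw [← Finset.sum_mul, sum_norm_sq_row hVV, one_mul]
    have e2 : ∑ j, ((Wᴴ * ρ * W) j j).re * Real.log (s j) =
        ∑ i, ∑ j, ‖V i j‖ ^ 2 * r i * Real.log (s j) := by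
      rw [Finset.sum_comm]
      exact Finset.sum_congr rfl fun j _ => by rw [hdiag, Finset.sum_mul]
    rw [e1, e2, ← Finset.sum_sub_distrib]
    refine Finset.sum_congr rfl fun i _ => ?_
    rw [← Finset.sum_sub_distrib]
    exact Finset.sum_congr rfl fun j _ => by ring
  · -- the variational bound, tested on the operators `x P + x' (1 - P)`
    have hpos : 0 < Q + T * p := by positivity
    have hpos' : 0 < Q' + T * p' := by positivity
    set x : ℝ := p / (Q + T * p) with hx
    set x' : ℝ := p' / (Q' + T * p') with hx'
    set X : Matrix n n ℂ := (x : ℂ) • P + (x' : ℂ) • (1 - P) with hX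
    have hXs : Xᴴ = X := by
      rw [hX, conjTranspose_add, conjTranspose_smul, conjTranspose_smul, conjTranspose_sub, hP,
        conjTranspose_one]
      simp
    have hXX : X * X = ((x ^ 2 : ℝ) : ℂ) • P + ((x' ^ 2 : ℝ) : ℂ) • (1 - P) := by
      have h1 : P * (1 - P) = 0 := by rw [mul_sub, mul_one, hPP, sub_self]
      have h2 : (1 - P) * P = 0 := by rw [sub_mul, one_mul, hPP, sub_self]
      have h3 : (1 - P) * (1 - P) = 1 - P := by rw [mul_sub, mul_one, h2, sub_zero]
      rw [hX]
      simp only [add_mul, mul_add, smul_mul_assoc, mul_smul_comm, h1, h2, h3, hPP, smul_zero,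
        add_zero, zero_add, smul_smul, pow_two, Complex.ofReal_mul]
    have htrace : ∀ (τ : Matrix n n ℂ) (y y' : ℝ),
        (trace (τ * ((y : ℂ) • P + (y' : ℂ) • (1 - P)))).re =
          y * (trace (τ * P)).re + y' * (trace (τ * (1 - P))).re := by
      intro τ y y'
      rw [mul_add, trace_add, mul_smul_comm, mul_smul_comm, trace_smul, trace_smul,
        Complex.add_re, smul_eq_mul, smul_eq_mul, Complex.re_ofReal_mul, Complex.re_ofReal_mul]
    set Y : Matrix n n ℂ := Uᴴ * X * W with hY
    have hYs : Yᴴ = Wᴴ * X * U := by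
      rw [hY, conjTranspose_mul, conjTranspose_mul, conjTranspose_conjTranspose, hXs, mul_assoc]
    have t1 : ∑ i, ∑ j, r i * (Y i j * star (V i j)).re = x * p + x' * p' := by
      rw [← hp, ← hp', ← htrace, ← hX, ← trace_diagonal_mul_mul_conjTranspose, hρ, hY, hVdef,
        conjTranspose_mul, conjTranspose_conjTranspose]
      congr 1
      rw [show diagonal (fun i => (r i : ℂ)) * (Uᴴ * X * W) * (Wᴴ * U) =
        diagonal (fun i => (r i : ℂ)) * (Uᴴ * X * (W * Wᴴ) * U) by simp only [mul_assoc], hW',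
        mul_one, ← mul_assoc, trace_mul_comm]
      simp only [mul_assoc]
    have t2 : ∑ i, ∑ j, ‖Y i j‖ ^ 2 * s j ≤ x ^ 2 * Q + x' ^ 2 * Q' := by
      have : ∑ i, ∑ j, ‖Y i j‖ ^ 2 * s j =
          x ^ 2 * (trace (σ * P)).re + x' ^ 2 * (trace (σ * (1 - P))).re := by
        rw [← htrace, ← hXX, ← trace_mul_diagonal_mul_conjTranspose, hYs, hY]
        congr 1
        rw [show Uᴴ * X * W * diagonal (fun i => (s i : ℂ)) * (Wᴴ * X * U) =
          Uᴴ * (X * (W * diagonal (fun i => (s i : ℂ)) * Wᴴ) * X * U) by simp only [mul_assoc],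
          ← hσ, trace_mul_comm, mul_assoc, hU', mul_one, mul_assoc, trace_mul_comm, mul_assoc]
      rw [this]
      gcongr
    have t3 : ∑ i, ∑ j, ‖Y i j‖ ^ 2 * r i = x ^ 2 * p + x' ^ 2 * p' := by
      have : ∑ i, ∑ j, ‖Y i j‖ ^ 2 * r i = ∑ i, ∑ j, r i * (Y i j * star (Y i j)).re :=
        Finset.sum_congr rfl fun i _ => Finset.sum_congr rfl fun j _ => by
          rw [mul_star_re, mul_comm]
      rw [this, ← hp, ← hp', ← htrace, ← hXX, ← trace_diagonal_mul_mul_conjTranspose, hYs, hρ, hY]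
      congr 1
      rw [show diagonal (fun i => (r i : ℂ)) * (Uᴴ * X * W) * (Wᴴ * X * U) =
        diagonal (fun i => (r i : ℂ)) * (Uᴴ * X * (W * Wᴴ) * X * U) by simp only [mul_assoc], hW',
        mul_one, ← mul_assoc, trace_mul_comm]
      simp only [mul_assoc]
    have hpt : ∀ i j, 2 * (r i * (Y i j * star (V i j)).re) - ‖Y i j‖ ^ 2 * s j -
        T * (‖Y i j‖ ^ 2 * r i) ≤ ‖V i j‖ ^ 2 * (r i ^ 2 / (s j + T * r i)) :=
      fun i j => two_mul_re_sub_le (hr i) (hs j) hT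
    have hall := Finset.sum_le_sum fun i (_ : i ∈ Finset.univ) =>
      Finset.sum_le_sum fun j (_ : j ∈ Finset.univ) => hpt i j
    simp only [Finset.sum_sub_distrib, ← Finset.mul_sum] at hall
    simp only [Finset.mul_sum] at hall t1 t2 t3
    rw [Fintype.sum_prod_type]
    refine le_trans ?_ hall
    simp only [← Finset.mul_sum] at t1 t2 t3 ⊢
    rw [t1, t3]
    have f1 : p ^ 2 / (Q + T * p) = 2 * (x * p) - x ^ 2 * (Q + T * p) := by
      rw [hx]; field_simp; ring
    have f2 : p' ^ 2 / (Q' + T * p') = 2 * (x' * p') - x' ^ 2 * (Q' + T * p') := by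
      rw [hx']; field_simp; ring
    linarith

/-! ### Entropy of matrices -/

section Entropy

variable {n m : Type*} [Fintype n] [DecidableEq n] [Fintype m] [DecidableEq m]

theorem isHermitian_eq_mul_diagonal_mul {A : Matrix n n ℂ} (hA : A.IsHermitian) :
    A = (hA.eigenvectorUnitary : Matrix n n ℂ) * diagonal (fun i => (hA.eigenvalues i : ℂ)) *
      (hA.eigenvectorUnitary : Matrix n n ℂ)ᴴ := by
  conv_lhs => rw [hA.spectral_theorem]
  rw [Unitary.conjStarAlgAut_apply]
  rfl

theorem conjTranspose_mul_eigenvectorUnitary {A : Matrix n n ℂ} (hA : A.IsHermitian) :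
    (hA.eigenvectorUnitary : Matrix n n ℂ)ᴴ * (hA.eigenvectorUnitary : Matrix n n ℂ) = 1 :=
  Unitary.coe_star_mul_self hA.eigenvectorUnitary

theorem entropy_eq_sum_roots {A : Matrix n n ℂ} (hA : A.IsHermitian) :
    entropy A hA = (A.charpoly.roots.map fun z => Real.negMulLog z.re).sum := by
  rw [hA.roots_charpoly_eq_eigenvalues, Multiset.map_map]
  simp [entropy]

/-- The entropy only sees the nonzero part of the spectrum. -/
theorem entropy_eq_of_charpoly {A : Matrix n n ℂ} {B : Matrix m m ℂ} (hA : A.IsHermitian)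
    (hB : B.IsHermitian) {j k : ℕ}
    (h : Polynomial.X ^ j * A.charpoly = Polynomial.X ^ k * B.charpoly) :
    entropy A hA = entropy B hB := by
  have hroots : ∀ (l : ℕ) (p : Polynomial ℂ), p.Monic →
      ((Polynomial.X ^ l * p).roots.map fun z : ℂ => Real.negMulLog z.re).sum =
        (p.roots.map fun z : ℂ => Real.negMulLog z.re).sum := by
    intro l p hp
    rw [Polynomial.roots_mul ((Polynomial.monic_X_pow l).mul hp).ne_zero, Polynomial.roots_X_pow]
    simp [Multiset.map_nsmul, Multiset.sum_nsmul]
  rw [entropy_eq_sum_roots, entropy_eq_sum_roots, ← hroots j _ (charpoly_monic A),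
    ← hroots k _ (charpoly_monic B), h]

/-- Dephasing in the standard basis does not decrease the entropy, and the increase is at most
quadratic in the off-diagonal entries: it is the relative entropy of `ρ` and its diagonal part, and
`x - 1` bounds `log x` from above. -/
theorem entropy_le_sum_negMulLog_diag {ρ : Matrix n n ℂ} (hρ : ρ.PosSemidef) {p : n → ℝ}
    (hp : ∀ a, (ρ a a).re = p a) (hp0 : ∀ a, 0 < p a) :
    entropy ρ hρ.1 ≤ ∑ a, Real.negMulLog (p a) ∧
    ∑ a, Real.negMulLog (p a) - entropy ρ hρ.1 ≤ ∑ a, (∑ b, ‖ρ a b‖ ^ 2 / p a - p a) := by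
  set U : Matrix n n ℂ := (hρ.1.eigenvectorUnitary : Matrix n n ℂ)
  set r := hρ.1.eigenvalues
  have hUU : Uᴴ * U = 1 := conjTranspose_mul_eigenvectorUnitary hρ.1
  have hUU' : U * Uᴴ = 1 := mul_eq_one_comm.1 hUU
  have hr : ∀ i, 0 ≤ r i := hρ.eigenvalues_nonneg
  have hspec : ρ = U * diagonal (fun i => (r i : ℂ)) * Uᴴ := isHermitian_eq_mul_diagonal_mul hρ.1
  set V : Matrix n n ℂ := Uᴴ
  have hVr : V * Vᴴ = 1 := by rw [conjTranspose_conjTranspose]; exact hUU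
  have hVc : Vᴴ * V = 1 := by rw [conjTranspose_conjTranspose]; exact hUU'
  have hd1 : ∀ a, ∑ i, ‖V i a‖ ^ 2 * r i = p a := fun a => by
    rw [← conjTranspose_mul_diagonal_mul_apply, conjTranspose_conjTranspose, ← hspec, hp]
  have hd2 : ∀ a, ∑ i, ‖V i a‖ ^ 2 * r i ^ 2 = ∑ b, ‖ρ a b‖ ^ 2 := fun a => by
    have hsq : Vᴴ * diagonal (fun i => ((r i ^ 2 : ℝ) : ℂ)) * V = ρ * ρᴴ := by
      rw [hρ.1.eq]
      conv_rhs => rw [hspec]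
      rw [conjTranspose_conjTranspose,
        show U * diagonal (fun i => (r i : ℂ)) * V * (U * diagonal (fun i => (r i : ℂ)) * V) =
          U * (diagonal (fun i => (r i : ℂ)) * (V * U) * diagonal (fun i => (r i : ℂ))) * V by
          simp only [mul_assoc], hUU, mul_one, diagonal_mul_diagonal]
      simp only [pow_two, Complex.ofReal_mul]
    rw [← conjTranspose_mul_diagonal_mul_apply, hsq, mul_apply, Complex.re_sum]
    exact Finset.sum_congr rfl fun b _ => by rw [conjTranspose_apply, mul_star_re]
  have hdiff : ∑ a, Real.negMulLog (p a) - entropy ρ hρ.1 =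
      ∑ a, ∑ i, ‖V i a‖ ^ 2 * (r i * (Real.log (r i) - Real.log (p a))) := by
    have e1 : entropy ρ hρ.1 = ∑ a, ∑ i, ‖V i a‖ ^ 2 * (-(r i * Real.log (r i))) := by
      rw [Finset.sum_comm]
      refine Finset.sum_congr rfl fun i _ => ?_
      rw [← Finset.sum_mul, sum_norm_sq_row hVr, one_mul, Real.negMulLog]
      ring
    have e2 : ∑ a, Real.negMulLog (p a) = ∑ a, ∑ i, ‖V i a‖ ^ 2 * r i * (-Real.log (p a)) :=
      Finset.sum_congr rfl fun a _ => by
        rw [← Finset.sum_mul, hd1, Real.negMulLog]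
        ring
    rw [e1, e2, ← Finset.sum_sub_distrib]
    refine Finset.sum_congr rfl fun a _ => ?_
    rw [← Finset.sum_sub_distrib]
    exact Finset.sum_congr rfl fun i _ => by ring
  constructor
  · rw [← sub_nonneg, hdiff]
    have hlow : ∀ a i, ‖V i a‖ ^ 2 * r i - ‖V i a‖ ^ 2 * p a ≤
        ‖V i a‖ ^ 2 * (r i * (Real.log (r i) - Real.log (p a))) := by
      intro a i
      rw [← mul_sub]
      refine mul_le_mul_of_nonneg_left ?_ (sq_nonneg _)
      rcases (hr i).eq_or_lt with h0 | h0
      · rw [← h0]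
        simpa using (hp0 a).le
      · have := Real.log_le_sub_one_of_pos (div_pos (hp0 a) h0)
        rw [Real.log_div (hp0 a).ne' h0.ne'] at this
        have h2 := mul_le_mul_of_nonneg_left this h0.le
        have h3 : r i * (p a / r i - 1) = p a - r i := by field_simp
        linarith
    have hrsum : ∑ i, r i = ∑ a, p a := by
      rw [Finset.sum_congr rfl fun a _ => (hd1 a).symm, Finset.sum_comm]
      exact Finset.sum_congr rfl fun i _ => by rw [← Finset.sum_mul, sum_norm_sq_row hVr, one_mul]
    refine le_trans (le_of_eq ?_) (Finset.sum_le_sum fun a _ => Finset.sum_le_sum fun i _ =>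
      hlow a i)
    simp only [Finset.sum_sub_distrib]
    rw [Finset.sum_congr rfl fun a _ => hd1 a,
      Finset.sum_congr rfl fun a _ => show ∑ i, ‖V i a‖ ^ 2 * p a = p a by
        rw [← Finset.sum_mul, sum_norm_sq_col hVc, one_mul], sub_self]
  · rw [hdiff]
    refine Finset.sum_le_sum fun a _ => ?_
    rw [← Finset.sum_div, ← hd2, ← hd1 a, Finset.sum_div, ← Finset.sum_sub_distrib]
    refine Finset.sum_le_sum fun i _ => ?_
    rw [hd1 a, mul_div_assoc, ← mul_sub]
    refine mul_le_mul_of_nonneg_left ?_ (sq_nonneg _)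
    rcases (hr i).eq_or_lt with h0 | h0
    · simp [← h0]
    · have := Real.log_le_sub_one_of_pos (div_pos h0 (hp0 a))
      rw [Real.log_div h0.ne' (hp0 a).ne'] at this
      have h2 := mul_le_mul_of_nonneg_left this h0.le
      have h3 : r i * (r i / p a - 1) = r i ^ 2 / p a - r i := by ring
      linarith

end Entropy

/-! ### Conditional entropy -/

/-- The block-diagonal operator `∑ a, |a⟩⟨a| ⊗ A a`. -/
def controlled {m k : Type*} [DecidableEq m] (A : m → Matrix k k ℂ) : Matrix (m × k) (m × k) ℂ :=
  (blockDiagonal A).submatrix Prod.swap Prod.swap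

/-- The diagonal block `⟨a| ρ |a⟩` of an operator on a tensor product. -/
def block {m k : Type*} (a : m) (ρ : Matrix (m × k) (m × k) ℂ) : Matrix k k ℂ :=
  ρ.submatrix (Prod.mk a) (Prod.mk a)

theorem controlled_apply {m k : Type*} [DecidableEq m] (A : m → Matrix k k ℂ) (i j : m × k) :
    controlled A i j = if i.1 = j.1 then A i.1 i.2 j.2 else 0 := by
  simp [controlled, blockDiagonal_apply]

theorem controlled_conjTranspose {m k : Type*} [DecidableEq m] (A : m → Matrix k k ℂ) :
    (controlled A)ᴴ = controlled fun a => (A a)ᴴ := by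
  rw [controlled, conjTranspose_submatrix, blockDiagonal_conjTranspose, controlled]

theorem controlled_one {m k : Type*} [DecidableEq m] [DecidableEq k] :
    controlled (fun _ : m => (1 : Matrix k k ℂ)) = 1 := by
  ext i j
  simp only [controlled_apply, one_apply, Prod.ext_iff]
  split_ifs <;> simp_all

theorem controlled_diagonal {m k : Type*} [DecidableEq m] [DecidableEq k] (v : k → ℂ) :
    controlled (fun _ : m => diagonal v) = diagonal fun i : m × k => v i.2 := by
  ext i j
  simp only [controlled_apply, diagonal_apply, Prod.ext_iff]
  split_ifs <;> simp_all

theorem trace_eq_sum_trace_block {m k : Type*} [Fintype m] [Fintype k]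
    (ρ : Matrix (m × k) (m × k) ℂ) :
    trace ρ = ∑ a, trace (block a ρ) := by
  simp [trace, block, Fintype.sum_prod_type]

theorem traceLeft_eq_sum_block {m k : Type*} [Fintype m] (ρ : Matrix (m × k) (m × k) ℂ) :
    traceLeft ρ = ∑ a, block a ρ := by
  ext x y
  simp [traceLeft, block, Matrix.sum_apply]

theorem posSemidef_traceLeft {m k : Type*} [Fintype m] {ρ : Matrix (m × k) (m × k) ℂ}
    (hρ : ρ.PosSemidef) :
    (traceLeft ρ).PosSemidef := by
  rw [traceLeft_eq_sum_block]
  exact posSemidef_sum _ fun a _ => hρ.submatrix _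

section Conditional

variable {m k : Type*} [Fintype m] [DecidableEq m] [Fintype k]

theorem controlled_mul (A B : m → Matrix k k ℂ) :
    controlled A * controlled B = controlled fun a => A a * B a := by
  rw [controlled, controlled, controlled, blockDiagonal_mul]
  exact submatrix_mul_equiv _ _ _ (Equiv.prodComm m k) _

theorem block_mul_controlled (ρ : Matrix (m × k) (m × k) ℂ) (A : m → Matrix k k ℂ) (a : m) :
    block a (ρ * controlled A) = block a ρ * A a := by
  ext x y
  simp [block, mul_apply, Fintype.sum_prod_type, controlled_apply]

theorem block_controlled_mul (ρ : Matrix (m × k) (m × k) ℂ) (A : m → Matrix k k ℂ) (a : m) :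
    block a (controlled A * ρ) = A a * block a ρ := by
  ext x y
  simp [block, mul_apply, Fintype.sum_prod_type, controlled_apply]

variable [DecidableEq k]

/-- The conditional entropy `H(ρ) - H(tr₁ ρ)` is at most the classical entropy of guessing the
first factor by measuring the second: if the projections `P a` identify the branch `a` with total
probability `p`, it obeys Fano's bound. It is minus the relative entropy of `ρ` and `1 ⊗ tr₁ ρ`,
which is measured with the projection `∑ a, |a⟩⟨a| ⊗ P a`. -/
theorem fano_le_entropy_sub_entropy [Nonempty m] {ρ : Matrix (m × k) (m × k) ℂ}
    (hρ : ρ.PosSemidef) (htr : (trace ρ).re = 1) {P : m → Matrix k k ℂ} (hP : ∀ a, (P a)ᴴ = P a)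
    (hPP : ∀ a, P a * P a = P a) {p : ℝ} (hp0 : 0 ≤ p) (hp1 : p ≤ 1)
    (hp : ∑ a, (trace (block a ρ * P a)).re = p)
    (hq : ∑ a, (trace (traceLeft ρ * P a)).re ≤ 1)
    (hq0 : 0 ≤ ∑ a, (trace (traceLeft ρ * P a)).re) :
    p * Real.log p + (1 - p) * (Real.log (1 - p) - Real.log (Fintype.card m)) ≤
      entropy (traceLeft ρ) (posSemidef_traceLeft hρ).1 - entropy ρ hρ.1 := by
  have hσ := posSemidef_traceLeft hρ
  set σ := traceLeft ρ
  set W : Matrix k k ℂ := (hσ.1.eigenvectorUnitary : Matrix k k ℂ)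
  set s := hσ.1.eigenvalues
  have hWW : Wᴴ * W = 1 := conjTranspose_mul_eigenvectorUnitary hσ.1
  have hspec : σ = W * diagonal (fun i => (s i : ℂ)) * Wᴴ := isHermitian_eq_mul_diagonal_mul hσ.1
  have hblockT : ∀ a x, (((controlled fun _ : m => W)ᴴ * ρ * controlled fun _ : m => W)
      (a, x) (a, x)) = (Wᴴ * block a ρ * W) x x := by
    intro a x
    rw [controlled_conjTranspose, ← block_controlled_mul (A := fun _ : m => Wᴴ),
      ← block_mul_controlled (A := fun _ : m => W)]
    rfl
  -- the diagonal blocks of `ρ` add up to `σ`, so both sums with `log s` are over the spectrum of `σ`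
  have hblocksum : ∀ x, ∑ a, ((Wᴴ * block a ρ * W) x x).re = s x := by
    intro x
    rw [← Complex.re_sum, ← Matrix.sum_apply, ← Finset.sum_mul, ← Finset.mul_sum,
      ← traceLeft_eq_sum_block, show traceLeft ρ = σ from rfl, hspec,
      show Wᴴ * (W * diagonal (fun i => (s i : ℂ)) * Wᴴ) * W =
        (Wᴴ * W) * diagonal (fun i => (s i : ℂ)) * (Wᴴ * W) by simp only [mul_assoc], hWW, one_mul,
      mul_one, diagonal_apply_eq, Complex.ofReal_re]
  have hblock0 : ∀ a x, 0 ≤ ((Wᴴ * block a ρ * W) x x).re := fun a x =>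
    (Complex.le_def.1 ((hρ.submatrix (Prod.mk a)).conjTranspose_mul_mul_same W).diag_nonneg).1
  have hσtr : (trace σ).re = 1 := by
    rw [← htr, trace_eq_sum_trace_block ρ, show σ = ∑ a, block a ρ from traceLeft_eq_sum_block ρ,
      trace_sum]
  have htr2 : (trace (ρ * (1 - controlled P))).re = 1 - p := by
    rw [mul_sub, mul_one, trace_sub, Complex.sub_re, htr, trace_eq_sum_trace_block (ρ * _),
      Complex.re_sum, ← hp]
    simp only [block_mul_controlled]
  have htrσ : (trace ((controlled fun _ : m => σ) * controlled P)).re =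
      ∑ a, (trace (σ * P a)).re := by
    rw [controlled_mul, trace_eq_sum_trace_block, Complex.re_sum]
    refine Finset.sum_congr rfl fun a _ => ?_
    congr 2
    ext x y
    simp [block, controlled_apply]
  have key := measured_relative_entropy_le (ρ := ρ) (σ := controlled fun _ : m => σ)
    (P := controlled P) (W := controlled fun _ : m => W) (s := fun i : m × k => s i.2)
    (conjTranspose_mul_eigenvectorUnitary hρ.1)
    (by rw [controlled_conjTranspose, controlled_mul, hWW, controlled_one])
    (isHermitian_eq_mul_diagonal_mul hρ.1)
    (by rw [← controlled_diagonal fun x => (s x : ℂ), controlled_conjTranspose, controlled_mul, controlled_mul]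
        exact congrArg controlled (funext fun _ => hspec))
    hρ.eigenvalues_nonneg (fun i => hσ.eigenvalues_nonneg i.2)
    -- the kernel of `1 ⊗ σ` lies in that of `ρ`: a vanishing sum of nonnegative blocks
    (fun j hj => by
      obtain ⟨a, x⟩ := j
      rw [hblockT]
      refine le_antisymm ?_ (hblock0 a x)
      rw [← show s x = 0 from hj, ← hblocksum x]
      exact Finset.single_le_sum (f := fun a => ((Wᴴ * block a ρ * W) x x).re)
        (fun b _ => hblock0 b x) (Finset.mem_univ a))
    (by rw [controlled_conjTranspose]; exact congrArg controlled (funext hP))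
    (by rw [controlled_mul]; exact congrArg controlled (funext hPP))
    (p := p) (p' := 1 - p) (Q := 1) (Q' := Fintype.card m)
    (by rw [← hp, trace_eq_sum_trace_block, Complex.re_sum]; simp only [block_mul_controlled])
    htr2 hp0 (by linarith) one_pos (by exact_mod_cast Fintype.card_pos)
    (by rw [htrσ]; exact hq)
    (by
      rw [mul_sub, mul_one, trace_sub, Complex.sub_re, htrσ, trace_eq_sum_trace_block,
        Complex.re_sum]
      have : ∀ a, (trace (block a (controlled fun _ : m => σ))).re = 1 := fun a => by
        rw [← hσtr]
        congr 2
        ext x y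
        simp [block, controlled_apply]
      simp only [this, Finset.sum_const, Finset.card_univ, nsmul_eq_mul, mul_one]
      linarith)
  rw [Real.log_one, sub_zero] at key
  refine key.trans (le_of_eq ?_)
  have e1 : entropy ρ hρ.1 = -∑ i, hρ.1.eigenvalues i * Real.log (hρ.1.eigenvalues i) := by
    rw [← Finset.sum_neg_distrib]
    exact Finset.sum_congr rfl fun i _ => by rw [Real.negMulLog, neg_mul]
  have e2 : entropy σ hσ.1 = -∑ x, s x * Real.log (s x) := by
    rw [← Finset.sum_neg_distrib]
    exact Finset.sum_congr rfl fun i _ => by rw [Real.negMulLog, neg_mul]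
  have e3 : ∑ j : m × k, (((controlled fun _ : m => W)ᴴ * ρ * controlled fun _ : m => W) j j).re *
      Real.log (s j.2) = ∑ x, s x * Real.log (s x) := by
    rw [Fintype.sum_prod_type_right]
    simp only [hblockT, ← Finset.sum_mul, hblocksum]
  rw [e1, e2, e3]
  ring

end Conditional

/-! ### Operators on a fraction of the environment -/

section Environment

variable {d q N : ℕ}

/-- Configurations of the environment as pairs of a configuration on `F` and one outside `F`. -/
def glueEquiv (q : ℕ) {N : ℕ} (F : Finset (Fin N)) :
    Config q F × ({j // j ∉ F} → Fin q) ≃ (Fin N → Fin q) :=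
  (Equiv.piEquivPiSubtypeProd (fun j => j ∈ F) fun _ => Fin q).symm

theorem glueEquiv_apply (F : Finset (Fin N)) (p : Config q F × ({j // j ∉ F} → Fin q)) :
    glueEquiv q F p = glue p.1 p.2 := rfl

theorem glue_of_mem {F : Finset (Fin N)} (x : Config q F) (z : {j // j ∉ F} → Fin q) (j : F) :
    glue x z j = x j := by
  simp [glue]

theorem glue_of_notMem {F : Finset (Fin N)} (x : Config q F) (z : {j // j ∉ F} → Fin q)
    (j : {j // j ∉ F}) : glue x z j = z j := by
  simp [glue, j.2]

theorem glue_eq_glue_iff {F : Finset (Fin N)} (x y : Config q F) (z w : {j // j ∉ F} → Fin q) :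
    glue x z = glue y w ↔ x = y ∧ z = w := by
  rw [← glueEquiv_apply F (x, z), ← glueEquiv_apply F (y, w), (glueEquiv q F).injective.eq_iff,
    Prod.mk.injEq]

theorem embed_glue (F : Finset (Fin N)) (A : Matrix (Config q F) (Config q F) ℂ)
    (x y : Config q F) (z w : {j // j ∉ F} → Fin q) :
    embed F A (glue x z) (glue y w) = if z = w then A x y else 0 := by
  have h : (∀ j, j ∉ F → glue x z j = glue y w j) ↔ z = w := by
    constructor
    · intro h
      funext j
      simpa only [glue_of_notMem] using h j j.2
    · rintro rfl j hj
      rw [glue_of_notMem x z ⟨j, hj⟩, glue_of_notMem y z ⟨j, hj⟩]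
  simp only [embed, of_apply, h, glue_of_mem]

/-- `A ↦ A ⊗ 1` as a homomorphism of star algebras. -/
def embedHom (q : ℕ) {N : ℕ} (F : Finset (Fin N)) :
    Matrix (Config q F) (Config q F) ℂ →⋆ₐ[ℂ] Matrix (Fin N → Fin q) (Fin N → Fin q) ℂ where
  toFun := embed F
  map_one' := by
    ext σ τ
    obtain ⟨⟨x, z⟩, rfl⟩ := (glueEquiv q F).surjective σ
    obtain ⟨⟨y, w⟩, rfl⟩ := (glueEquiv q F).surjective τ
    simp only [glueEquiv_apply, embed_glue, one_apply, glue_eq_glue_iff]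
    split_ifs <;> simp_all
  map_mul' A B := by
    ext σ τ
    obtain ⟨⟨x, z⟩, rfl⟩ := (glueEquiv q F).surjective σ
    obtain ⟨⟨y, w⟩, rfl⟩ := (glueEquiv q F).surjective τ
    rw [mul_apply, ← (glueEquiv q F).sum_comp]
    simp only [glueEquiv_apply, embed_glue, Fintype.sum_prod_type, mul_apply]
    split_ifs with h <;> simp [h]
  map_zero' := by
    ext σ τ
    simp [embed]
  map_add' A B := by
    ext σ τ
    simp only [embed, of_apply, Matrix.add_apply]
    split_ifs <;> simp
  commutes' r := by
    ext σ τ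
    obtain ⟨⟨x, z⟩, rfl⟩ := (glueEquiv q F).surjective σ
    obtain ⟨⟨y, w⟩, rfl⟩ := (glueEquiv q F).surjective τ
    simp only [glueEquiv_apply, embed_glue, algebraMap_matrix_apply, glue_eq_glue_iff]
    split_ifs <;> simp_all
  map_star' A := by
    ext σ τ
    obtain ⟨⟨x, z⟩, rfl⟩ := (glueEquiv q F).surjective σ
    obtain ⟨⟨y, w⟩, rfl⟩ := (glueEquiv q F).surjective τ
    simp only [glueEquiv_apply, star_eq_conjTranspose, conjTranspose_apply, embed_glue,
      eq_comm (a := z)]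
    split_ifs <;> simp

theorem embedHom_apply (F : Finset (Fin N)) (A : Matrix (Config q F) (Config q F) ℂ) :
    embedHom q F A = embed F A := rfl

theorem continuous_embedHom (F : Finset (Fin N)) : Continuous (embedHom q F) := by
  refine continuous_matrix fun σ τ => ?_
  simp only [embedHom_apply, embed, of_apply]
  split_ifs
  · fun_prop
  · exact continuous_const

theorem exists_embed_eq_embed {X F : Finset (Fin N)} (hXF : X ⊆ F)
    {A : Matrix (Config q X) (Config q X) ℂ} (hA : A.IsHermitian) :
    ∃ K : Matrix (Config q F) (Config q F) ℂ, K.IsHermitian ∧ embed F K = embed X A := by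
  refine ⟨Matrix.of fun σ τ => if ∀ j : F, (j : Fin N) ∉ X → σ j = τ j then
    A (fun j => σ ⟨j, hXF j.2⟩) (fun j => τ ⟨j, hXF j.2⟩) else 0, ?_, ?_⟩
  · ext σ τ
    simp only [conjTranspose_apply, of_apply, eq_comm (a := τ _)]
    split_ifs
    · exact hA.apply _ _
    · exact star_zero _
  · ext σ τ
    simp only [embed, of_apply]
    by_cases h1 : ∀ j, j ∉ X → σ j = τ j
    · rw [if_pos h1, if_pos fun j hj => h1 j fun hx => hj (hXF hx),
        if_pos fun (j : F) hj => h1 j hj]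
    · rw [if_neg h1]
      split_ifs with h2 h3
      · refine absurd (fun j hj => ?_) h1
        by_cases hF : j ∈ F
        · exact h3 ⟨j, hF⟩ hj
        · exact h2 j hF
      · rfl
      · rfl

/-- The restricted Hamiltonian `H_F` acts on the sites of `F` only. -/
theorem Interaction.exists_embed_eq_ham (h : Interaction q N) (F : Finset (Fin N)) :
    ∃ K : Matrix (Config q F) (Config q F) ℂ, K.IsHermitian ∧ embed F K = h.ham F := by
  have hK : ∀ X : Finset (Fin N), ∃ K : Matrix (Config q F) (Config q F) ℂ,
      K.IsHermitian ∧ (X ∈ F.powerset → embed F K = embed X (h.term X)) := by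
    intro X
    by_cases hX : X ⊆ F
    · obtain ⟨K, hK, hKX⟩ := exists_embed_eq_embed hX (h.isHermitian X)
      exact ⟨K, hK, fun _ => hKX⟩
    · exact ⟨0, isHermitian_zero, fun hX' => absurd (Finset.mem_powerset.1 hX') hX⟩
  choose K hKh hKX using hK
  refine ⟨∑ X ∈ F.powerset, K X, ?_, ?_⟩
  · rw [IsHermitian, conjTranspose_sum]
    exact Finset.sum_congr rfl fun X _ => (hKh X).eq
  · rw [← embedHom_apply, map_sum, Interaction.ham]
    exact Finset.sum_congr rfl fun X hX => hKX X hX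

/-! ### Reduced states -/

theorem traceRight_pureState {m k : Type*} [Fintype k] (v : EuclideanSpace ℂ (m × k)) :
    traceRight (pureState v) =
      (of fun i z => v (i, z) : Matrix m k ℂ) * (of fun i z => v (i, z) : Matrix m k ℂ)ᴴ := by
  ext i j
  simp [traceRight, pureState, mul_apply]

theorem posSemidef_traceRight_pureState {m k : Type*} [Fintype m] [Fintype k]
    (v : EuclideanSpace ℂ (m × k)) : (traceRight (pureState v)).PosSemidef := by
  rw [traceRight_pureState]
  exact posSemidef_self_mul_conjTranspose _

/-- The global state is pure, so the two sides of the cut `(S F) | Fᶜ` have the same entropy. -/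
theorem entropy_rhoSF_eq (F : Finset (Fin N)) (Ψ : EuclideanSpace ℂ (Fin d × (Fin N → Fin q))) :
    entropy (rhoSF F Ψ) (rhoSF_isHermitian F Ψ) =
      entropy (rhoF Fᶜ Ψ) (rhoF_isHermitian Fᶜ Ψ) := by
  let M : Matrix (Fin d × Config q F) ({j // j ∉ F} → Fin q) ℂ := of fun i z => split F Ψ (i, z)
  let e : Config q Fᶜ ≃ ({j // j ∉ F} → Fin q) :=
    (Equiv.subtypeEquivRight fun j => Finset.mem_compl).arrowCongr (Equiv.refl _)
  let e' : ({j // j ∉ Fᶜ} → Fin q) ≃ Config q F :=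
    (Equiv.subtypeEquivRight fun j => by simp).arrowCongr (Equiv.refl _)
  have hglue : ∀ (y : Config q Fᶜ) (x : {j // j ∉ Fᶜ} → Fin q),
      glue y x = glue (e' x) (e y) := by
    intro y x
    funext j
    by_cases hj : j ∈ F
    · have hj' : j ∉ Fᶜ := by simpa using hj
      simp only [glue, hj, hj', dif_pos, dif_neg, not_false_eq_true]
      rfl
    · have hj' : j ∈ Fᶜ := by simpa using hj
      simp only [glue, hj, hj', dif_pos, dif_neg, not_false_eq_true]
      rfl
  have h1 : rhoSF F Ψ = M * Mᴴ := traceRight_pureState _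
  have h2 : rhoF Fᶜ Ψ = reindex e.symm e.symm (Mᴴ * M)ᵀ := by
    ext y w
    simp only [rhoF, rhoSF, traceLeft, traceRight, pureState, split, of_apply, reindex_apply,
      submatrix_apply, transpose_apply, mul_apply, conjTranspose_apply, M, Fintype.sum_prod_type,
      Equiv.symm_symm, hglue]
    refine Finset.sum_congr rfl fun a _ => ?_
    rw [← e'.sum_comp]
    exact Finset.sum_congr rfl fun x _ => mul_comm _ _
  refine entropy_eq_of_charpoly _ _ (j := Fintype.card ({j // j ∉ F} → Fin q))
    (k := Fintype.card (Fin d × Config q F)) ?_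
  rw [h2, charpoly_reindex, charpoly_transpose, h1]
  exact charpoly_mul_comm' M Mᴴ

theorem entropy_rhoF_eq (F : Finset (Fin N)) (Ψ : EuclideanSpace ℂ (Fin d × (Fin N → Fin q))) :
    entropy (rhoF F Ψ) (rhoF_isHermitian F Ψ) =
      entropy (rhoSF Fᶜ Ψ) (rhoSF_isHermitian Fᶜ Ψ) := by
  rw [entropy_rhoSF_eq]
  have : ∀ G : Finset (Fin N), G = F → entropy (rhoF F Ψ) (rhoF_isHermitian F Ψ) =
      entropy (rhoF G Ψ) (rhoF_isHermitian G Ψ) := by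
    rintro _ rfl
    rfl
  exact this _ (compl_compl F)

/-- Expectation values of an operator on `F` in branch `a` of the state. -/
theorem trace_block_rhoSF_mul (F : Finset (Fin N)) (c : Fin d → ℂ)
    (φ : Fin d → EuclideanSpace ℂ (Fin N → Fin q)) (a : Fin d)
    (P : Matrix (Config q F) (Config q F) ℂ) :
    trace (block a (rhoSF F (branchState c φ)) * P) =
      ((‖c a‖ ^ 2 : ℝ) : ℂ) * (star (φ a).ofLp ⬝ᵥ (embed F P *ᵥ (φ a).ofLp)) := by
  have hc : ((‖c a‖ ^ 2 : ℝ) : ℂ) = c a * star (c a) := by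
    rw [Complex.star_def, Complex.mul_conj, Complex.normSq_eq_norm_sq]
  simp only [dotProduct, mulVec]
  rw [← (glueEquiv q F).sum_comp]
  simp_rw [← (glueEquiv q F).sum_comp (fun τ => embed F P _ τ * _)]
  simp only [glueEquiv_apply, embed_glue, Fintype.sum_prod_type, trace, diag_apply, mul_apply,
    block, submatrix_apply, rhoSF, traceRight, pureState, split, branchState, of_apply, hc]
  simp only [ite_mul, zero_mul, Finset.sum_ite_eq, Finset.mem_univ, if_true, Finset.mul_sum,
    Finset.sum_mul, Pi.star_apply, star_mul']
  rw [Finset.sum_comm]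
  refine Finset.sum_congr rfl fun x _ => ?_
  rw [Finset.sum_comm]
  refine Finset.sum_congr rfl fun z _ => Finset.sum_congr rfl fun y _ => ?_
  ring

end Environment

/-! ### Measuring the energy of a fraction -/

section Law

variable {ι : Type*} [Fintype ι] [DecidableEq ι] {A : Matrix ι ι ℂ}

theorem observableLaw_real (hA : A.IsHermitian) (n : ℕ) (v : EuclideanSpace ℂ ι) (U : Set ℝ)
    [DecidablePred (· ∈ U)] :
    (observableLaw hA n v).real U =
      ∑ i, if hA.eigenvalues i / n ∈ U then ‖inner ℂ (hA.eigenvectorBasis i) v‖ ^ 2 else 0 := by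
  rw [MeasureTheory.measureReal_def, observableLaw, MeasureTheory.Measure.finsetSum_apply,
    ENNReal.toReal_sum]
  · refine Finset.sum_congr rfl fun i _ => ?_
    rw [MeasureTheory.Measure.smul_apply, MeasureTheory.Measure.dirac_apply, smul_eq_mul,
      ENNReal.toReal_mul, ENNReal.toReal_ofReal (sq_nonneg _)]
    by_cases h : hA.eigenvalues i / n ∈ U <;> simp [h]
  · intro i _
    rw [MeasureTheory.Measure.smul_apply, smul_eq_mul]
    exact ENNReal.mul_ne_top ENNReal.ofReal_ne_top (MeasureTheory.measure_ne_top _ _)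

theorem isProbabilityMeasure_observableLaw (hA : A.IsHermitian) (n : ℕ) {v : EuclideanSpace ℂ ι}
    (hv : ‖v‖ = 1) : MeasureTheory.IsProbabilityMeasure (observableLaw hA n v) := by
  constructor
  have h1 : ∑ i, ‖inner ℂ (hA.eigenvectorBasis i) v‖ ^ 2 = 1 := by
    rw [OrthonormalBasis.sum_sq_norm_inner_right, hv, one_pow]
  rw [observableLaw, MeasureTheory.Measure.finsetSum_apply]
  simp only [MeasureTheory.Measure.smul_apply, MeasureTheory.measure_univ, smul_eq_mul, mul_one]
  rw [← ENNReal.ofReal_sum_of_nonneg fun i _ => sq_nonneg _, h1, ENNReal.ofReal_one]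

theorem star_dotProduct_cfc_mulVec (hA : A.IsHermitian) (f : ℝ → ℝ) (v : EuclideanSpace ℂ ι) :
    star v.ofLp ⬝ᵥ (cfc f A *ᵥ v.ofLp) =
      ((∑ i, f (hA.eigenvalues i) * ‖inner ℂ (hA.eigenvectorBasis i) v‖ ^ 2 : ℝ) : ℂ) := by
  set W : Matrix ι ι ℂ := (hA.eigenvectorUnitary : Matrix ι ι ℂ) with hW
  have hcfc : cfc f A = W * diagonal (fun i => (f (hA.eigenvalues i) : ℂ)) * Wᴴ := by
    rw [hA.cfc_eq, IsHermitian.cfc, Unitary.conjStarAlgAut_apply]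
    rfl
  have hcoord : ∀ i, (Wᴴ *ᵥ v.ofLp) i = inner ℂ (hA.eigenvectorBasis i) v := by
    intro i
    rw [EuclideanSpace.inner_eq_star_dotProduct, dotProduct_comm]
    simp only [mulVec, dotProduct, conjTranspose_apply, hW, IsHermitian.eigenvectorUnitary_apply,
      Pi.star_apply]
  have h2 : star v.ofLp ᵥ* W = star (Wᴴ *ᵥ v.ofLp) := by
    rw [star_mulVec, conjTranspose_conjTranspose]
  rw [hcfc, mul_assoc, ← mulVec_mulVec, dotProduct_mulVec, h2, ← mulVec_mulVec, dotProduct]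
  push_cast
  refine Finset.sum_congr rfl fun i _ => ?_
  rw [mulVec_diagonal, Pi.star_apply, hcoord, mul_left_comm, Complex.star_def,
    ← Complex.normSq_eq_conj_mul_self, Complex.normSq_eq_norm_sq]
  push_cast
  rfl

/-- Two states whose laws are separated by `U` are nearly orthogonal. -/
theorem norm_inner_sq_le (hA : A.IsHermitian) (n : ℕ) {v w : EuclideanSpace ℂ ι} (hv : ‖v‖ = 1)
    (hw : ‖w‖ = 1) (U : Set ℝ) :
    ‖inner ℂ v w‖ ^ 2 ≤
      2 * ((observableLaw hA n v).real Uᶜ + (observableLaw hA n w).real U) := by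
  classical
  set b := hA.eigenvectorBasis
  set S : Finset ι := {i | hA.eigenvalues i / n ∈ U} with hS
  have hsplit : inner ℂ v w = ∑ i ∈ S, inner ℂ v (b i) * inner ℂ (b i) w +
      ∑ i ∈ Sᶜ, inner ℂ v (b i) * inner ℂ (b i) w := by
    rw [Finset.sum_add_sum_compl, b.sum_inner_mul_inner]
  have hone : ∀ {u : EuclideanSpace ℂ ι} (hu : ‖u‖ = 1) (T : Finset ι),
      ∑ i ∈ T, ‖inner ℂ (b i) u‖ ^ 2 ≤ 1 := by
    intro u hu T
    have h1 : ∑ i, ‖inner ℂ (b i) u‖ ^ 2 = 1 := by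
      rw [OrthonormalBasis.sum_sq_norm_inner_right, hu, one_pow]
    rw [← h1]
    exact Finset.sum_le_univ_sum_of_nonneg fun i => sq_nonneg _
  have hCS : ∀ T : Finset ι, ‖∑ i ∈ T, inner ℂ v (b i) * inner ℂ (b i) w‖ ^ 2 ≤
      (∑ i ∈ T, ‖inner ℂ (b i) v‖ ^ 2) * ∑ i ∈ T, ‖inner ℂ (b i) w‖ ^ 2 := by
    intro T
    refine le_trans (pow_le_pow_left₀ (norm_nonneg _) (norm_sum_le _ _) 2) ?_
    have := Finset.sum_mul_sq_le_sq_mul_sq T (fun i => ‖inner ℂ (b i) v‖)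
      fun i => ‖inner ℂ (b i) w‖
    refine le_trans (le_of_eq ?_) this
    congr 1
    exact Finset.sum_congr rfl fun i _ => by rw [norm_mul, norm_inner_symm]
  have e1 : ∑ i ∈ S, ‖inner ℂ (b i) w‖ ^ 2 = (observableLaw hA n w).real U := by
    rw [observableLaw_real, hS, Finset.sum_filter]
  have e2 : ∑ i ∈ Sᶜ, ‖inner ℂ (b i) v‖ ^ 2 = (observableLaw hA n v).real Uᶜ := by
    rw [observableLaw_real, hS, Finset.compl_filter, Finset.sum_filter]
    rfl
  have h1 : ‖∑ i ∈ S, inner ℂ v (b i) * inner ℂ (b i) w‖ ^ 2 ≤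
      (observableLaw hA n w).real U := by
    refine (hCS S).trans ?_
    rw [e1]
    exact mul_le_of_le_one_left MeasureTheory.measureReal_nonneg (hone hv S)
  have h2 : ‖∑ i ∈ Sᶜ, inner ℂ v (b i) * inner ℂ (b i) w‖ ^ 2 ≤
      (observableLaw hA n v).real Uᶜ := by
    refine (hCS Sᶜ).trans ?_
    rw [e2]
    exact mul_le_of_le_one_right MeasureTheory.measureReal_nonneg (hone hw Sᶜ)
  rw [hsplit]
  refine le_trans (pow_le_pow_left₀ (norm_nonneg _) (norm_add_le _ _) 2) ?_
  refine (add_sq_le).trans ?_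
  linarith

end Law

section Environment

variable {d q N : ℕ}

/-- The event that the energy density of `F` lies in `U` is a projection acting on `F` only. -/
theorem Interaction.exists_projection (h : Interaction q N) (F : Finset (Fin N)) (U : Set ℝ) :
    ∃ P : Matrix (Config q F) (Config q F) ℂ, Pᴴ = P ∧ P * P = P ∧
      ∀ v : EuclideanSpace ℂ (Fin N → Fin q),
        star v.ofLp ⬝ᵥ (embed F P *ᵥ v.ofLp) = (((energyLaw h F v).real U : ℝ) : ℂ) := by
  classical
  obtain ⟨K, hK, hKF⟩ := h.exists_embed_eq_ham F
  let f : ℝ → ℝ := fun E => if E / F.card ∈ U then 1 else 0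
  have hcont : ContinuousOn f (spectrum ℝ K) := finite_real_spectrum.continuousOn f
  refine ⟨cfc f K, ?_, ?_, fun v => ?_⟩
  · exact (cfc_predicate f K : IsSelfAdjoint _)
  · rw [← cfc_mul f f K hcont hcont]
    refine congrArg (fun g => cfc g K) (funext fun E => ?_)
    simp [f]
  · have hemb : (embedHom q F K).IsHermitian := by
      rw [embedHom_apply, hKF]
      exact h.ham_isHermitian F
    have hmap : embed F (cfc f K) = cfc f (h.ham F) := by
      have := StarAlgHom.map_cfc (embedHom q F) f K hcont (continuous_embedHom F) hK hemb
      rwa [embedHom_apply, embedHom_apply, hKF] at this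
    rw [hmap, star_dotProduct_cfc_mulVec (h.ham_isHermitian F), energyLaw, observableLaw_real]
    congr 1
    exact Finset.sum_congr rfl fun i _ => by simp [f]

theorem norm_evolve (h : Interaction q N) (t : ℝ) (φ : EuclideanSpace ℂ (Fin N → Fin q)) :
    ‖h.evolve t φ‖ = ‖φ‖ := by
  set B := (-(Complex.I * t)) • h.ham Finset.univ with hB
  have hBs : Bᴴ = -B := by
    rw [hB, conjTranspose_smul, (h.ham_isHermitian _).eq, ← neg_smul]
    simp
  have hunit : (NormedSpace.exp B)ᴴ * NormedSpace.exp B = 1 := by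
    rw [← exp_conjTranspose, hBs, ← exp_add_of_commute _ _ (Commute.refl B).neg_left,
      neg_add_cancel, NormedSpace.exp_zero]
  have hinner : inner ℂ (h.evolve t φ) (h.evolve t φ) = inner ℂ φ φ := by
    rw [EuclideanSpace.inner_eq_star_dotProduct, EuclideanSpace.inner_eq_star_dotProduct,
      dotProduct_comm, dotProduct_comm φ.ofLp]
    change star (NormedSpace.exp B *ᵥ φ.ofLp) ⬝ᵥ (NormedSpace.exp B *ᵥ φ.ofLp) = _
    rw [star_mulVec, dotProduct_mulVec, vecMul_vecMul, hunit, vecMul_one]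
  rw [inner_self_eq_norm_sq_to_K, inner_self_eq_norm_sq_to_K] at hinner
  have h2 : ‖h.evolve t φ‖ ^ 2 = ‖φ‖ ^ 2 := by exact_mod_cast hinner
  exact (pow_left_inj₀ (norm_nonneg _) (norm_nonneg _) two_ne_zero).1 h2

theorem isProbabilityMeasure_energyLaw (h : Interaction q N) (F : Finset (Fin N))
    {φ : EuclideanSpace ℂ (Fin N → Fin q)} (hφ : ‖φ‖ = 1) :
    MeasureTheory.IsProbabilityMeasure (energyLaw h F φ) :=
  isProbabilityMeasure_observableLaw _ _ hφ

theorem trace_rhoSF_branchState (F : Finset (Fin N)) {c : Fin d → ℂ} (hc : ∑ a, ‖c a‖ ^ 2 = 1)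
    {φ : Fin d → EuclideanSpace ℂ (Fin N → Fin q)} (hφ : ∀ a, ‖φ a‖ = 1) :
    (trace (rhoSF F (branchState c φ))).re = 1 := by
  rw [trace_eq_sum_trace_block, Complex.re_sum, ← hc]
  refine Finset.sum_congr rfl fun a _ => ?_
  have := trace_block_rhoSF_mul F c φ a 1
  rw [mul_one, ← embedHom_apply, map_one, one_mulVec] at this
  rw [this, Complex.re_ofReal_mul, dotProduct_comm, ← EuclideanSpace.inner_eq_star_dotProduct,
    inner_self_eq_norm_sq_to_K, hφ]
  simp

/-- Guessing the branch from the energy density of `F` by means of the disjoint regions `U a`. -/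
theorem fano_energyLaw (h : Interaction q N) (F : Finset (Fin N)) {c : Fin d → ℂ}
    (hc : ∑ a, ‖c a‖ ^ 2 = 1) {φ : Fin d → EuclideanSpace ℂ (Fin N → Fin q)}
    (hφ : ∀ a, ‖φ a‖ = 1) {U : Fin d → Set ℝ} (hU : ∀ a, MeasurableSet (U a))
    (hdisj : Pairwise fun a b => Disjoint (U a) (U b)) {p : ℝ}
    (hp : ∑ a, ‖c a‖ ^ 2 * (energyLaw h F (φ a)).real (U a) = p) :
    p * Real.log p + (1 - p) * (Real.log (1 - p) - Real.log d) ≤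
      entropy (rhoF F (branchState c φ)) (rhoF_isHermitian F _) -
        entropy (rhoSF F (branchState c φ)) (rhoSF_isHermitian F _) := by
  have hprob : ∀ a, MeasureTheory.IsProbabilityMeasure (energyLaw h F (φ a)) := fun a =>
    isProbabilityMeasure_energyLaw h F (hφ a)
  choose P hP hPP hPE using fun a => h.exists_projection F (U a)
  have hd : Nonempty (Fin d) := by
    by_contra hne
    rw [not_nonempty_iff] at hne
    simp at hc
  have hex : ∀ a b, (trace (block b (rhoSF F (branchState c φ)) * P a)).re =
      ‖c b‖ ^ 2 * (energyLaw h F (φ b)).real (U a) := fun a b => by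
    rw [trace_block_rhoSF_mul, hPE, ← Complex.ofReal_mul, Complex.ofReal_re]
  have hexF : ∑ a, (trace (traceLeft (rhoSF F (branchState c φ)) * P a)).re =
      ∑ b, ‖c b‖ ^ 2 * ∑ a, (energyLaw h F (φ b)).real (U a) := by
    simp only [Finset.mul_sum]
    rw [Finset.sum_comm]
    refine Finset.sum_congr rfl fun a _ => ?_
    rw [traceLeft_eq_sum_block, Finset.sum_mul, trace_sum, Complex.re_sum]
    exact Finset.sum_congr rfl fun b _ => hex a b
  have hle1 : ∀ b, ∑ a, (energyLaw h F (φ b)).real (U a) ≤ 1 := fun b => by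
    rw [← MeasureTheory.measureReal_biUnion_finset (fun a _ a' _ haa => hdisj haa)
      fun a _ => hU a]
    exact MeasureTheory.measureReal_le_one
  have key := fano_le_entropy_sub_entropy (ρ := rhoSF F (branchState c φ)) (P := P) (p := p)
    (posSemidef_traceRight_pureState _) (trace_rhoSF_branchState F hc hφ) hP hPP
    (by rw [← hp]
        exact Finset.sum_nonneg fun a _ =>
          mul_nonneg (sq_nonneg _) MeasureTheory.measureReal_nonneg)
    (by rw [← hp, ← hc]
        exact Finset.sum_le_sum fun a _ =>
          mul_le_of_le_one_right (sq_nonneg _) MeasureTheory.measureReal_le_one)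
    (by rw [← hp]; exact Finset.sum_congr rfl fun a _ => hex a a)
    (by rw [hexF, ← hc]
        exact Finset.sum_le_sum fun b _ => mul_le_of_le_one_right (sq_nonneg _) (hle1 b))
    (by rw [hexF]
        exact Finset.sum_nonneg fun b _ => mul_nonneg (sq_nonneg _)
          (Finset.sum_nonneg fun a _ => MeasureTheory.measureReal_nonneg))
  rw [Fintype.card_fin] at key
  exact key

/-- The system decoheres in the branch basis: its entropy is that of the branch weights, up to the
squared overlaps of the branch states. -/
theorem abs_entropyS_sub_le {c : Fin d → ℂ} (hc0 : ∀ a, 0 < ‖c a‖ ^ 2)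
    (hc : ∑ a, ‖c a‖ ^ 2 = 1) {φ : Fin d → EuclideanSpace ℂ (Fin N → Fin q)}
    (hφ : ∀ a, ‖φ a‖ = 1) {η : ℝ} (hη0 : 0 ≤ η)
    (hη : ∀ a b, a ≠ b → ‖inner ℂ (φ a) (φ b)‖ ^ 2 ≤ η) :
    |entropyS (branchState c φ) - -∑ a, ‖c a‖ ^ 2 * Real.log (‖c a‖ ^ 2)| ≤ d * η := by
  have hentry : ∀ a b, rhoS (branchState c φ) a b =
      c a * star (c b) * inner ℂ (φ b) (φ a) := by
    intro a b
    rw [EuclideanSpace.inner_eq_star_dotProduct]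
    simp only [rhoS, traceRight, pureState, branchState, of_apply, dotProduct, Finset.mul_sum,
      Pi.star_apply, star_mul']
    exact Finset.sum_congr rfl fun σ _ => by ring
  have hnorm : ∀ a b, ‖rhoS (branchState c φ) a b‖ ^ 2 =
      ‖c a‖ ^ 2 * ‖c b‖ ^ 2 * ‖inner ℂ (φ b) (φ a)‖ ^ 2 := by
    intro a b
    rw [hentry, norm_mul, norm_mul, norm_star]
    ring
  have hself : ∀ a, inner ℂ (φ a) (φ a) = (1 : ℂ) := fun a => by
    rw [inner_self_eq_norm_sq_to_K, hφ]
    simp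
  obtain ⟨h1, h2⟩ := entropy_le_sum_negMulLog_diag (ρ := rhoS (branchState c φ))
    (p := fun a => ‖c a‖ ^ 2) (posSemidef_traceRight_pureState _)
    (fun a => by rw [hentry, hself, mul_one, mul_star_re]) hc0
  have hrow : ∀ a, ∑ b, ‖rhoS (branchState c φ) a b‖ ^ 2 / ‖c a‖ ^ 2 - ‖c a‖ ^ 2 ≤ η := by
    intro a
    have hb : ∀ b, ‖rhoS (branchState c φ) a b‖ ^ 2 / ‖c a‖ ^ 2 ≤
        ‖c b‖ ^ 2 * η + if b = a then ‖c a‖ ^ 2 else 0 := by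
      intro b
      rw [hnorm, mul_assoc, mul_div_cancel_left₀ _ (hc0 a).ne']
      split_ifs with hba
      · rw [hba, hself, norm_one, one_pow, mul_one]
        nlinarith [mul_nonneg (hc0 a).le hη0]
      · rw [add_zero]
        exact mul_le_mul_of_nonneg_left (hη b a hba) (hc0 b).le
    refine (sub_le_sub_right (Finset.sum_le_sum fun b _ => hb b) _).trans (le_of_eq ?_)
    rw [Finset.sum_add_distrib, ← Finset.sum_mul, hc, Finset.sum_ite_eq']
    simp
  have hrows := Finset.sum_le_sum fun a (_ : a ∈ Finset.univ) => hrow a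
  simp only [Finset.sum_const, Finset.card_univ, Fintype.card_fin, nsmul_eq_mul] at hrows
  have hneg : -∑ a, ‖c a‖ ^ 2 * Real.log (‖c a‖ ^ 2) = ∑ a, Real.negMulLog (‖c a‖ ^ 2) := by
    rw [← Finset.sum_neg_distrib]
    exact Finset.sum_congr rfl fun a _ => by rw [Real.negMulLog, neg_mul]
  rw [hneg, abs_sub_comm, entropyS, abs_of_nonneg (sub_nonneg.2 h1)]
  exact h2.trans hrows

end Environment

/-! ### Large deviations separate the branches -/

theorem exists_open_separation {ι X : Type*} [Finite ι] [TopologicalSpace X] [NormalSpace X]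
    {K : ι → Set X} (hK : ∀ a, IsClosed (K a)) (hdisj : Pairwise fun a b => Disjoint (K a) (K b)) :
    ∃ U : ι → Set X, (∀ a, IsOpen (U a)) ∧ (∀ a, K a ⊆ U a) ∧
      Pairwise fun a b => Disjoint (U a) (U b) := by
  have hsep : ∀ a, SeparatedNhds (K a) (⋃ b : {b // b ≠ a}, K b) := fun a =>
    normal_separation (hK a) (isClosed_iUnion_of_finite fun b => hK b)
      (Set.disjoint_iUnion_right.2 fun b => hdisj b.2.symm)
  choose V W hV hW hKV hKW hVW using hsep
  refine ⟨fun a => V a ∩ ⋂ b : {b // b ≠ a}, W b, fun a => (hV a).inter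
    (isOpen_iInter_of_finite fun b => hW b), fun a => Set.subset_inter (hKV a)
    (Set.subset_iInter fun b => ?_), fun a b hab => ?_⟩
  · exact (Set.subset_iUnion (fun c : {c // c ≠ (b : ι)} => K c) ⟨a, b.2.symm⟩).trans (hKW b)
  · refine (hVW a).mono Set.inter_subset_left (Set.inter_subset_right.trans ?_)
    exact Set.iInter_subset (fun c : {c // c ≠ b} => W c) ⟨a, hab⟩

theorem measureReal_le_exp_of_log_div_lt {μ : MeasureTheory.Measure ℝ} {K : Set ℝ} {α : ℝ} {n : ℕ}
    (hn : 0 < n) (h : ENNReal.log (μ K) / ((n : ℝ) : EReal) < ((-α : ℝ) : EReal)) :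
    μ.real K ≤ Real.exp (-(α * n)) := by
  have hn' : (0 : EReal) < ((n : ℝ) : EReal) := by exact_mod_cast hn
  rw [EReal.div_lt_iff hn' (EReal.coe_ne_top _), ← EReal.coe_mul] at h
  have h2 : ENNReal.log (μ K) < ENNReal.log (ENNReal.ofReal (Real.exp (-(α * n)))) := by
    rw [ENNReal.log_ofReal_of_pos (Real.exp_pos _), Real.log_exp]
    simpa using h
  exact ENNReal.toReal_le_of_le_ofReal (Real.exp_pos _).le (ENNReal.log_lt_log_iff.1 h2).le

/-- Below `α_*` the sublevel sets of the rate functions are disjoint; disjoint open neighbourhoods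
of them identify the branch with exponentially small error. -/
theorem exists_separating_regions {d : ℕ} {ι : Type*} {r : ι → ℕ}
    {μ : Fin d → ι → MeasureTheory.Measure ℝ}
    (hμ : ∀ a i, MeasureTheory.IsProbabilityMeasure (μ a i)) {f : Fin d → ℝ → ℝ≥0∞}
    (hf : ∀ a, IsLDP (Filter.comap r Filter.atTop) r (μ a) (f a)) {α : ℝ}
    (hα : (α : EReal) < (alphaStar f : EReal)) :
    ∃ U : Fin d → Set ℝ, (∀ a, MeasurableSet (U a)) ∧
      (Pairwise fun a b => Disjoint (U a) (U b)) ∧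
      ∃ C : ℝ, 0 < C ∧ ∀ a i, (μ a i).real (U a)ᶜ ≤ C * Real.exp (-(α * r i)) := by
  -- for negative rates the bound exceeds `1`, and no separation is available if `α_* = 0`
  rcases lt_or_ge α 0 with hneg | hα0
  · refine ⟨fun _ => ∅, fun _ => MeasurableSet.empty, fun _ _ _ => disjoint_bot_left, 1, one_pos,
      fun a i => ?_⟩
    rw [one_mul]
    refine MeasureTheory.measureReal_le_one.trans (Real.one_le_exp ?_)
    nlinarith [(Nat.cast_nonneg (r i) : (0 : ℝ) ≤ r i)]
  obtain ⟨β, hαβ, hβ⟩ := EReal.lt_iff_exists_real_btwn.1 hα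
  rw [EReal.coe_lt_coe_iff] at hαβ
  have hβ0 : 0 ≤ β := hα0.trans hαβ.le
  have hβcoe : ((ENNReal.ofReal β : ℝ≥0∞) : EReal) = (β : EReal) := by
    rw [EReal.coe_ennreal_ofReal, max_eq_left hβ0]
  have hβ' : ENNReal.ofReal β < alphaStar f := by
    rw [← EReal.coe_ennreal_lt_coe_ennreal_iff, hβcoe]
    exact hβ
  obtain ⟨U, hUo, hKU, hUd⟩ := exists_open_separation
    (K := fun a => f a ⁻¹' Set.Iic (ENNReal.ofReal β))
    (fun a => (hf a).lsc.isClosed_preimage _) (fun a b hab => by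
      refine Set.disjoint_left.2 ?_
      intro x hxa hxb
      refine absurd hβ' (not_lt.2 ?_)
      exact (iInf_le_of_le a <| iInf_le_of_le b <| iInf_le_of_le hab <| iInf_le_of_le x le_rfl).trans
        (max_le hxa hxb))
  have hev : ∀ a, ∃ n₀ : ℕ, ∀ i, n₀ ≤ r i → (μ a i).real (U a)ᶜ ≤ Real.exp (-(α * r i)) := by
    intro a
    have hinf : ENNReal.ofReal β ≤ ⨅ x ∈ (U a)ᶜ, f a x :=
      le_iInf₂ fun x hx => le_of_lt <| lt_of_not_ge fun hle => hx (hKU a hle)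
    have hlim := (hf a).upper (U a)ᶜ (hUo a).isClosed_compl
    have hlt : Filter.limsup (fun i => ENNReal.log (μ a i (U a)ᶜ) / ((r i : ℝ) : EReal))
        (Filter.comap r Filter.atTop) < ((-α : ℝ) : EReal) := by
      refine hlim.trans_lt (lt_of_le_of_lt (EReal.neg_le_neg_iff.2
        (EReal.coe_ennreal_le_coe_ennreal_iff.2 hinf)) ?_)
      rw [hβcoe, ← EReal.coe_neg, EReal.coe_lt_coe_iff]
      linarith
    have h1 := Filter.eventually_lt_of_limsup_lt hlt
    rw [Filter.eventually_comap, Filter.eventually_atTop] at h1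
    obtain ⟨n₀, hn₀⟩ := h1
    -- `n₀ + 1` keeps the speed positive, so that the division by it is a genuine one
    exact ⟨n₀ + 1, fun i hi =>
      measureReal_le_exp_of_log_div_lt (by omega) (hn₀ (r i) (by omega) i rfl)⟩
  choose n₀ hn₀ using hev
  refine ⟨U, fun a => (hUo a).measurableSet, hUd, Real.exp (α * (∑ a, n₀ a : ℕ)), Real.exp_pos _,
    fun a i => ?_⟩
  rw [← Real.exp_add]
  rcases le_or_gt (n₀ a) (r i) with hi | hi
  · refine (hn₀ a i hi).trans (Real.exp_le_exp.2 (le_add_of_nonneg_left ?_))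
    positivity
  · refine MeasureTheory.measureReal_le_one.trans (Real.one_le_exp ?_)
    have h1 : r i ≤ ∑ a, n₀ a :=
      hi.le.trans (Finset.single_le_sum (fun _ _ => Nat.zero_le _) (Finset.mem_univ a))
    have h2 : (r i : ℝ) ≤ (∑ a, n₀ a : ℕ) := by exact_mod_cast h1
    nlinarith

/-- Fano's bound for an exponentially small error; any slower rate `α < β` absorbs the factor `n`
coming from the logarithm. -/
theorem exists_fano_lower_bound {α β C D : ℝ} (hαβ : α < β) (hC : 0 < C) (hD : 1 ≤ D) :
    ∃ C' : ℝ, 0 < C' ∧ ∀ (n : ℕ) (δ : ℝ), 0 ≤ δ → δ ≤ 1 → δ ≤ C * Real.exp (-(β * n)) →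
      -(C' * Real.exp (-(α * n))) ≤
        (1 - δ) * Real.log (1 - δ) + δ * (Real.log δ - Real.log D) := by
  have hlogD : 0 ≤ Real.log D := Real.log_nonneg hD
  have hgap : 0 < β - α := sub_pos.2 hαβ
  refine ⟨C * (1 + Real.log D) + |β| * (C / (β - α)) + 1, by positivity, fun n δ hδ0 hδ1 hδ => ?_⟩
  have hexp : Real.exp (-(β * n)) = Real.exp (-(α * n)) * Real.exp (-((β - α) * n)) := by
    rw [← Real.exp_add]
    congr 1
    ring
  have hle1 : Real.exp (-((β - α) * n)) ≤ 1 := by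
    rw [Real.exp_le_one_iff, neg_nonpos]
    positivity
  have hE := Real.exp_pos (-(α * n))
  have hexple : Real.exp (-(β * n)) ≤ Real.exp (-(α * n)) := by
    rw [hexp]
    exact mul_le_of_le_one_right hE.le hle1
  have hδα : δ ≤ C * Real.exp (-(α * n)) := hδ.trans (mul_le_mul_of_nonneg_left hexple hC.le)
  have h1 : -δ ≤ (1 - δ) * Real.log (1 - δ) := by
    rcases (sub_nonneg.2 hδ1).eq_or_lt with h0 | h0
    · rw [← h0, zero_mul]
      linarith
    · have := mul_le_mul_of_nonneg_left (Real.one_sub_inv_le_log_of_pos h0) h0.le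
      rw [mul_sub, mul_inv_cancel₀ h0.ne'] at this
      linarith
  -- `log x ≤ x - 1` at `x = exp (-β n) / δ` compares `log δ` with `-β n`
  have h2 : -(|β| * (n * δ)) - Real.exp (-(β * n)) ≤ δ * Real.log δ := by
    rcases hδ0.eq_or_lt with h0 | h0
    · rw [← h0]
      simp [(Real.exp_pos _).le]
    · have h3 := Real.log_le_sub_one_of_pos (div_pos (Real.exp_pos (-(β * n))) h0)
      rw [Real.log_div (Real.exp_pos _).ne' h0.ne', Real.log_exp] at h3
      have h4 := mul_le_mul_of_nonneg_left h3 h0.le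
      have h5 : δ * (Real.exp (-(β * n)) / δ - 1) = Real.exp (-(β * n)) - δ := by field_simp
      have h6 : β * (n * δ) ≤ |β| * (n * δ) :=
        mul_le_mul_of_nonneg_right (le_abs_self β) (by positivity)
      nlinarith
  have hnδ : n * δ ≤ C / (β - α) * Real.exp (-(α * n)) := by
    have h3 : (β - α) * n * Real.exp (-((β - α) * n)) ≤ 1 := by
      rw [Real.exp_neg, ← div_eq_mul_inv, div_le_one (Real.exp_pos _)]
      linarith [Real.add_one_le_exp ((β - α) * n)]
    have h4 : (β - α) * (n * δ) ≤ C * Real.exp (-(α * n)) := by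
      calc (β - α) * (n * δ) ≤ (β - α) * (n * (C * Real.exp (-(β * n)))) := by gcongr
        _ = C * Real.exp (-(α * n)) * ((β - α) * n * Real.exp (-((β - α) * n))) := by
          rw [hexp]
          ring
        _ ≤ C * Real.exp (-(α * n)) := mul_le_of_le_one_right (by positivity) h3
    rw [div_mul_eq_mul_div, le_div_iff₀ hgap]
    linarith
  have h7 := mul_le_mul_of_nonneg_left hnδ (abs_nonneg β)
  have h8 := mul_le_mul_of_nonneg_right hδα hlogD
  nlinarith

end Redundancy

/-! ### Mutual information and the entropy of the system -/

theorem proposition1 {d q : ℕ}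
    -- the `N`-site environment Hamiltonians, the admissible fractions, and the times
    (h : (N : ℕ) → Redundancy.Interaction q N)
    (𝓕 : (N : ℕ) → Set (Finset (Fin N)))
    (h𝓕 : ∀ N, ∀ F ∈ 𝓕 N, Fᶜ ∈ 𝓕 N)
    (t : ℕ → ℝ)
    -- the amplitudes and the branch states at time zero
    (c : Fin d → ℂ) (hc0 : ∀ a, 0 < ‖c a‖ ^ 2) (hc : ∑ a, ‖c a‖ ^ 2 = 1)
    (Φ : (N : ℕ) → Fin d → EuclideanSpace ℂ (Fin N → Fin q)) (hΦ : ∀ N a, ‖Φ N a‖ = 1)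
    -- the branch states and the state of system and environment after time evolution
    (Φt : (N : ℕ) → Fin d → EuclideanSpace ℂ (Fin N → Fin q))
    (hΦt : ∀ N a, Φt N a = (h N).evolve (t N) (Φ N a))
    (Ψ : (N : ℕ) → EuclideanSpace ℂ (Fin d × (Fin N → Fin q)))
    (hΨ : ∀ N, Ψ N = Redundancy.branchState c (Φt N))
    -- large deviation principle for the energy density of a fraction, in each branch
    (f : Fin d → ℝ → ENNReal)
    (hf : ∀ a, Redundancy.IsLDP (Redundancy.largeFractions 𝓕) (fun p => p.2.1.card)
      (fun p => Redundancy.energyLaw (h p.1) p.2.1 (Φt p.1 a)) (f a)) :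
    (∀ α : ℝ, (α : EReal) < (Redundancy.alphaStar f : EReal) →
      ∃ C : ℝ, 0 < C ∧ ∀ N, ∀ F ∈ 𝓕 N,
        Redundancy.entropyS (Ψ N) - C * Real.exp (-(α * (F.card : ℝ)))
            ≤ Redundancy.mutualInfo F (Ψ N) ∧
        Redundancy.mutualInfo F (Ψ N)
            ≤ Redundancy.entropyS (Ψ N) + C * Real.exp (-(α * ((N : ℝ) - (F.card : ℝ))))) ∧
    (0 < Redundancy.alphaStar f →
      ∃ γ : ℝ, 0 < γ ∧ ∃ C : ℝ, 0 < C ∧ ∀ N, (𝓕 N).Nonempty →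
        |Redundancy.entropyS (Ψ N) - -∑ a, ‖c a‖ ^ 2 * Real.log (‖c a‖ ^ 2)|
          ≤ C * Real.exp (-(γ * (N : ℝ)))) := by
  open Redundancy in
  have hnorm : ∀ N a, ‖Φt N a‖ = 1 := fun N a => by rw [hΦt, norm_evolve, hΦ]
  have hprob : ∀ N F a, MeasureTheory.IsProbabilityMeasure (energyLaw (h N) F (Φt N a)) :=
    fun N F a => isProbabilityMeasure_energyLaw (h N) F (hnorm N a)
  have hcard : ∀ {N : ℕ} (F : Finset (Fin N)), ((Fᶜ.card : ℕ) : ℝ) = (N : ℝ) - F.card := by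
    intro N F
    rw [Finset.card_compl, Fintype.card_fin,
      Nat.cast_sub (by simpa using Finset.card_le_univ F)]
  have hsep := fun (α : ℝ) (hα : (α : EReal) < (alphaStar f : EReal)) =>
    exists_separating_regions (r := fun p : (N : ℕ) × {F : Finset (Fin N) // F ∈ 𝓕 N} =>
      p.2.1.card) (fun a p => hprob p.1 p.2.1 a) hf hα
  constructor
  · intro α hα
    obtain ⟨β, hαβ, hβ⟩ := EReal.lt_iff_exists_real_btwn.1 hα
    obtain ⟨U, hU, hdisj, C, hC, hle⟩ := hsep β hβ
    have hd : (1 : ℝ) ≤ d := by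
      rcases Nat.eq_zero_or_pos d with rfl | hd
      · simp at hc
      · exact_mod_cast hd
    obtain ⟨C', hC', hfano⟩ := exists_fano_lower_bound (EReal.coe_lt_coe_iff.1 hαβ) hC hd
    have hlow : ∀ N, ∀ F ∈ 𝓕 N, -(C' * Real.exp (-(α * F.card))) ≤
        entropy (rhoF F (Ψ N)) (rhoF_isHermitian F _) -
          entropy (rhoSF F (Ψ N)) (rhoSF_isHermitian F _) := by
      intro N F hF
      rw [hΨ]
      have hδ : 1 - ∑ a, ‖c a‖ ^ 2 * (energyLaw (h N) F (Φt N a)).real (U a) =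
          ∑ a, ‖c a‖ ^ 2 * (energyLaw (h N) F (Φt N a)).real (U a)ᶜ := by
        rw [sub_eq_iff_eq_add, ← Finset.sum_add_distrib, ← hc]
        refine Finset.sum_congr rfl fun a _ => ?_
        rw [← mul_add, add_comm, MeasureTheory.probReal_add_probReal_compl (hU a), mul_one]
      have hδ0 : 0 ≤ ∑ a, ‖c a‖ ^ 2 * (energyLaw (h N) F (Φt N a)).real (U a) :=
        Finset.sum_nonneg fun a _ => mul_nonneg (sq_nonneg _) MeasureTheory.measureReal_nonneg
      have hbound := hfano F.card (δ := 1 - ∑ a, ‖c a‖ ^ 2 *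
          (energyLaw (h N) F (Φt N a)).real (U a))
        (by rw [hδ]
            exact Finset.sum_nonneg fun a _ =>
              mul_nonneg (sq_nonneg _) MeasureTheory.measureReal_nonneg)
        (by linarith)
        (by rw [hδ]
            refine (Finset.sum_le_sum fun a _ =>
              mul_le_mul_of_nonneg_left (hle a ⟨N, F, hF⟩) (sq_nonneg ‖c a‖)).trans ?_
            rw [← Finset.sum_mul, hc, one_mul])
      rw [sub_sub_cancel] at hbound
      exact hbound.trans (fano_energyLaw (h N) F hc (hnorm N) hU hdisj rfl)
    refine ⟨C', hC', fun N F hF => ⟨?_, ?_⟩⟩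
    · have := hlow N F hF
      rw [mutualInfo]
      linarith
    · have := hlow N Fᶜ (h𝓕 N F hF)
      rw [hcard, ← entropy_rhoSF_eq, ← entropy_rhoF_eq] at this
      rw [mutualInfo]
      linarith
  · intro hpos
    obtain ⟨α, hα0, hα⟩ := EReal.lt_iff_exists_real_btwn.1
      (EReal.coe_ennreal_pos.2 hpos : (0 : EReal) < (alphaStar f : EReal))
    have hα0 : 0 < α := by exact_mod_cast hα0
    obtain ⟨U, hU, hdisj, C, hC, hle⟩ := hsep α hα
    refine ⟨α / 2, by positivity, d * (4 * C) + 1, by positivity, fun N hN => ?_⟩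
    -- `F` or its complement contains at least half of the sites
    obtain ⟨G, hG, hGcard⟩ : ∃ G ∈ 𝓕 N, (N : ℝ) / 2 ≤ G.card := by
      obtain ⟨F, hF⟩ := hN
      rcases le_total ((N : ℝ) / 2) F.card with hF2 | hF2
      · exact ⟨F, hF, hF2⟩
      · refine ⟨Fᶜ, h𝓕 N F hF, ?_⟩
        rw [hcard]
        linarith
    have hexp : Real.exp (-(α * G.card)) ≤ Real.exp (-(α / 2 * N)) := by
      rw [Real.exp_le_exp]
      nlinarith
    have hμ : ∀ a, (energyLaw (h N) G (Φt N a)).real (U a)ᶜ ≤ C * Real.exp (-(α / 2 * N)) :=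
      fun a => (hle a ⟨N, G, hG⟩).trans (mul_le_mul_of_nonneg_left hexp hC.le)
    have hη : ∀ a b, a ≠ b →
        ‖inner ℂ (Φt N a) (Φt N b)‖ ^ 2 ≤ 4 * (C * Real.exp (-(α / 2 * N))) := by
      intro a b hab
      refine (norm_inner_sq_le ((h N).ham_isHermitian G) G.card (hnorm N a) (hnorm N b)
        (U a)).trans ?_
      have h1 : (energyLaw (h N) G (Φt N b)).real (U a) ≤
          (energyLaw (h N) G (Φt N b)).real (U b)ᶜ :=
        MeasureTheory.measureReal_mono (hdisj hab).subset_compl_right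
      have h2 := hμ a
      have h3 := hμ b
      rw [energyLaw] at h1 h2 h3
      linarith
    rw [hΨ]
    refine (abs_entropyS_sub_le hc0 hc (hnorm N) (by positivity) hη).trans ?_
    nlinarith [Real.exp_pos (-(α / 2 * (N : ℝ)))]
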